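/- All digraphs are finite; a digraph $D$ consists of a vertex set $V(D)$ and a set of ordered pairs of vertices (its edges), so that both $uv$ and $vu$ may be edges. Its minimum semidegree $\delta^0(D)$ is the smallest in- or out-degree over all vertices of $D$, and $\Delta^+(D)$, $\Delta^-(D)$ denote its maximum out-degree and maximum in-degree. An oriented tree is a digraph obtained from an undirected tree by giving each edge exactly one direction. A copy of $T$ in $D$ is the image of an injection $V(T)\to V(D)$ that maps edges of $T$ to edges of $D$ with the same direction. There exist a function $f\colon(0,1]^2\to(0,1]$, non-decreasing in each variable, and a non-decreasing function $g\colon(0,1]\to(0,1]$ such that the following holds for all $\varepsilon,\alpha,c\in(0,1]$ and all integers $n\geq 1$ with $c\leq f(\varepsilon,\alpha)$ and $1/n\leq g(c)$. Let $D$ be an $n$-vertex digraph with $\delta^0(D)\geq(1/2+\alpha)n$ and let $v\in V(D)$. Let $T$ be an oriented tree with at most $(1-\varepsilon)n$ vertices, with $\Delta^+(T)\leq cn/\log n$ and $\Delta^-(T)\leq cn/\log n$, and let $t\in V(T)$. Then $D$ contains a copy of $T$ in which $t$ is mapped to $v$. -/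

import Mathlib

namespace Digraph

open Classical in
/-- The set `N⁺(v)` of out-neighbours of `v`. -/
noncomputable def outNbrs {V : Type*} [Fintype V] (D : Digraph V) (v : V) : Finset V :=
  Finset.univ.filter fun w => D.Adj v w

open Classical in
/-- The set `N⁻(v)` of in-neighbours of `v`. -/
noncomputable def inNbrs {V : Type*} [Fintype V] (D : Digraph V) (v : V) : Finset V :=
  Finset.univ.filter fun w => D.Adj w v

/-- The out-degree `d⁺(v)`. -/
noncomputable def outDeg {V : Type*} [Fintype V] (D : Digraph V) (v : V) : ℕ :=
  (D.outNbrs v).card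

/-- The in-degree `d⁻(v)`. -/
noncomputable def inDeg {V : Type*} [Fintype V] (D : Digraph V) (v : V) : ℕ :=
  (D.inNbrs v).card

/-- The minimum semidegree `δ⁰(D)`: the smallest in- or out-degree over the vertices of `D`
(it is `0` for the digraph without vertices). -/
noncomputable def minSemidegree {V : Type*} [Fintype V] (D : Digraph V) : ℕ :=
  ⨅ v : V, min (D.outDeg v) (D.inDeg v)

/-- The maximum out-degree `Δ⁺(D)`. -/
noncomputable def maxOutDeg {V : Type*} [Fintype V] (D : Digraph V) : ℕ :=
  Finset.univ.sup D.outDeg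

/-- The maximum in-degree `Δ⁻(D)`. -/
noncomputable def maxInDeg {V : Type*} [Fintype V] (D : Digraph V) : ℕ :=
  Finset.univ.sup D.inDeg

/-- `T` is an oriented tree: it arises from an undirected tree by giving each edge exactly one
of its two directions (so there are no loops and no pairs of opposite edges). -/
def IsOrientedTree {W : Type*} (T : Digraph W) : Prop :=
  (∀ a b : W, T.Adj a b → ¬ T.Adj b a) ∧ T.toSimpleGraphInclusive.IsTree

/-- `D` contains a copy of `T` in which `t` is copied to `v`: an injection of the vertices of `T`
into those of `D` that preserves directed edges and sends `t` to `v`. -/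
def ContainsCopyAt {V W : Type*} (D : Digraph V) (v : V) (T : Digraph W) (t : W) : Prop :=
  ∃ φ : W → V, Function.Injective φ ∧ (∀ a b : W, T.Adj a b → D.Adj (φ a) (φ b)) ∧ φ t = v

end Digraph

/-! The tree is embedded piece by piece, with random choices replaced by choices that do no worse
than the mean. Below `t` it is cut into pieces of at most `m` vertices and bounded height, with `m`
of order `n / log n`; the degree bound keeps the number of pieces below a small multiple of `n`
(`exists_fragmentation`). Each piece goes into the set `U` of unused vertices, which never has fewer
than `ε * n` elements. The invariant is that every vertex of `D` has more than a proportion `1/2 +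
α/2` of `U` as out-neighbours and as in-neighbours.

The invariant follows from a bound on the potential `∑ exp (-l * density)` over all vertices and
both directions, with `l` of order `log n / α`. If a piece occupied uniformly distributed points of
`U`, the first-order change of the potential would vanish on average, and the second-order change is
small because pieces are small (`densityPotential_sdiff_le`).

Near-uniformity is where semidegree above one half enters. Doubly stochastic kernels supported on
edges carry the uniform law from parent to child. A top vertex must be adjacent to the image of its
parent, so it cannot be uniform; but its law on that neighbourhood can be coupled with kernels that
make its children exactly uniform, in either direction (`exists_uniformizing_kernels`). Only one
vertex per piece is thus uncontrolled. Small kernel entries allow occupied points to be avoided at a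
factor `ρ` per level, harmless for bounded height (`exists_tree_placement`). All losses together fit
between the initial density `1/2 + 3α/4` and the required `1/2 + α/2`. -/

/-! ### Matchings, doubly stochastic kernels, choices below the mean. -/

open Classical in
/-- A bipartite relation with equal sides whose degrees are at least half has a perfect matching. -/
theorem exists_perm_of_half_degree {ι : Type*} [Fintype ι] (rel : ι → ι → Prop)
    (hrow : ∀ a, Fintype.card ι ≤ 2 * (Finset.univ.filter fun x => rel a x).card)
    (hcol : ∀ x, Fintype.card ι ≤ 2 * (Finset.univ.filter fun a => rel a x).card) :
    ∃ σ : Equiv.Perm ι, ∀ a, rel a (σ a) := by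
  have hall : ∀ s : Finset ι,
      s.card ≤ (s.biUnion fun a => Finset.univ.filter fun x => rel a x).card := by
    intro s
    rcases s.eq_empty_or_nonempty with rfl | ⟨a, ha⟩
    · simp
    -- Hall's condition: for at most half of the rows one row's degree suffices; more than half of
    -- the rows meet the neighbourhood of every column, hence see all columns.
    by_cases hs : 2 * s.card ≤ Fintype.card ι
    · have h1 : (Finset.univ.filter fun x => rel a x) ⊆
          s.biUnion fun a => Finset.univ.filter fun x => rel a x :=
        Finset.subset_biUnion_of_mem (fun a => Finset.univ.filter fun x => rel a x) ha
      have h2 := Finset.card_le_card h1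
      have h3 := hrow a
      omega
    · have h1 : (s.biUnion fun a => Finset.univ.filter fun x => rel a x) = Finset.univ := by
        rw [Finset.eq_univ_iff_forall]
        intro x
        by_contra hx
        have hd : Disjoint s (Finset.univ.filter fun a => rel a x) := by
          rw [Finset.disjoint_left]
          intro b hb hb'
          apply hx
          simp only [Finset.mem_biUnion, Finset.mem_filter, Finset.mem_univ, true_and] at hb' ⊢
          exact ⟨b, hb, hb'⟩
        have h2 := Finset.card_le_univ (s ∪ (Finset.univ.filter fun a => rel a x))
        rw [Finset.card_union_of_disjoint hd] at h2
        have h3 := hcol x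
        omega
      rw [h1]
      exact Finset.card_le_univ s
  obtain ⟨f, hf, hf'⟩ := (Finset.all_card_le_biUnion_card_iff_exists_injective _).1 hall
  refine ⟨Equiv.ofBijective f (Finite.injective_iff_bijective.1 hf), fun a => ?_⟩
  simpa using hf' a

open Classical in
/-- A bipartite relation with equal sides and degrees at least half plus `r` contains an
`r`-regular one. -/
theorem exists_regular_subrelation {ι : Type*} [Fintype ι] (rel : ι → ι → Prop) (r : ℕ)
    (hrow : ∀ a, Fintype.card ι + 2 * r ≤ 2 * (Finset.univ.filter fun x => rel a x).card)
    (hcol : ∀ x, Fintype.card ι + 2 * r ≤ 2 * (Finset.univ.filter fun a => rel a x).card) :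
    ∃ reg : ι → ι → Prop, (∀ a x, reg a x → rel a x) ∧
      (∀ a, (Finset.univ.filter fun x => reg a x).card = r) ∧
      (∀ x, (Finset.univ.filter fun a => reg a x).card = r) := by
  induction r with
  | zero => exact ⟨fun _ _ => False, by simp, by simp, by simp⟩
  | succ r ih =>
    obtain ⟨reg, hsub, hr, hc⟩ := ih (fun a => by have := hrow a; omega)
      (fun a => by have := hcol a; omega)
    -- Matchings are peeled off one by one: deleting the `r`-regular part costs `r` at each vertex
    -- and leaves at least half of all degrees.
    obtain ⟨σ, hσ⟩ := exists_perm_of_half_degree (fun a x => rel a x ∧ ¬ reg a x)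
      (fun a => by
        have h1 : (Finset.univ.filter fun x => rel a x) ⊆
            (Finset.univ.filter fun x => rel a x ∧ ¬ reg a x) ∪
              (Finset.univ.filter fun x => reg a x) := by
          intro x; simp; tauto
        have h2 := (Finset.card_le_card h1).trans (Finset.card_union_le _ _)
        have := hrow a
        have := hr a
        have key : Fintype.card ι ≤ 2 * (Finset.univ.filter fun x => rel a x ∧ ¬ reg a x).card := by
          omega
        convert key)
      (fun x => by
        have h1 : (Finset.univ.filter fun a => rel a x) ⊆
            (Finset.univ.filter fun a => rel a x ∧ ¬ reg a x) ∪
              (Finset.univ.filter fun a => reg a x) := by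
          intro a; simp; tauto
        have h2 := (Finset.card_le_card h1).trans (Finset.card_union_le _ _)
        have := hcol x
        have := hc x
        have key : Fintype.card ι ≤ 2 * (Finset.univ.filter fun a => rel a x ∧ ¬ reg a x).card := by
          omega
        convert key)
    refine ⟨fun a x => reg a x ∨ x = σ a, ?_, ?_, ?_⟩
    · rintro a x (h | rfl)
      · exact hsub a x h
      · exact (hσ a).1
    · intro a
      have : (Finset.univ.filter fun x => reg a x ∨ x = σ a) =
          insert (σ a) (Finset.univ.filter fun x => reg a x) := by
        ext x; simp; tauto
      have key : (Finset.univ.filter fun x => reg a x ∨ x = σ a).card = r + 1 := by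
        rw [this, Finset.card_insert_of_notMem (by simpa using (hσ a).2), hr]
      convert key
    · intro x
      have : (Finset.univ.filter fun a => reg a x ∨ x = σ a) =
          insert (σ.symm x) (Finset.univ.filter fun a => reg a x) := by
        ext a
        simp only [Finset.mem_filter, Finset.mem_univ, true_and, Finset.mem_insert,
          Equiv.eq_symm_apply]
        tauto
      have key : (Finset.univ.filter fun a => reg a x ∨ x = σ a).card = r + 1 := by
        rw [this, Finset.card_insert_of_notMem, hc]
        have := (hσ (σ.symm x)).2
        simpa using this
      convert key

/-- From a probability vector with entries at most `κ`, one can pick an index outside a small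
set at which a nonnegative function is not much above its mean. -/
theorem exists_le_mean_avoiding {V : Type*} [Fintype V] (Q H : V → ℝ) (Z : Finset V)
    (κ ρ : ℝ) (hQ : ∀ x, 0 ≤ Q x) (hQκ : ∀ x, Q x ≤ κ) (hsum : ∑ x, Q x = 1)
    (hH : ∀ x, 0 ≤ H x) (hρ0 : 0 ≤ ρ) (hρ : 1 ≤ ρ * (1 - κ * Z.card)) :
    ∃ x, x ∉ Z ∧ 0 < Q x ∧ H x ≤ ρ * ∑ x, Q x * H x := by
  classical
  -- The mass outside `Z` is at least `1 - κ * Z.card`, so values above `ρ` times the mean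
  -- throughout the support there would push the mean above itself.
  by_contra! hcon
  set E := ∑ x, Q x * H x with hE
  have hE0 : 0 ≤ E := Finset.sum_nonneg fun x _ => mul_nonneg (hQ x) (hH x)
  have hsplit := Finset.sum_compl_add_sum Z Q
  have hZ : ∑ x ∈ Z, Q x ≤ κ * Z.card := by
    calc _ ≤ ∑ x ∈ Z, κ := Finset.sum_le_sum fun x _ => hQκ x
      _ = _ := by simp [mul_comm]
  have hc : 1 - κ * Z.card ≤ ∑ x ∈ Zᶜ, Q x := by linarith
  have h1 : 1 - κ * Z.card > 0 := by
    by_contra h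
    have : ρ * (1 - κ * Z.card) ≤ 0 := mul_nonpos_of_nonneg_of_nonpos hρ0 (not_lt.1 h)
    linarith
  have hex : ∃ x ∈ Zᶜ, 0 < Q x := by
    by_contra! h
    have : ∑ x ∈ Zᶜ, Q x ≤ 0 := Finset.sum_nonpos h
    linarith
  obtain ⟨x0, hx0, hx0'⟩ := hex
  have hlt : ∑ x ∈ Zᶜ, Q x * (ρ * E) < ∑ x ∈ Zᶜ, Q x * H x := by
    apply Finset.sum_lt_sum
    · intro x hx
      rcases (hQ x).eq_or_lt with h | h
      · simp [← h]
      · exact mul_le_mul_of_nonneg_left (hcon x (by simpa using hx) h).le h.le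
    · exact ⟨x0, hx0, mul_lt_mul_of_pos_left (hcon x0 (by simpa using hx0) hx0') hx0'⟩
  have hle : ∑ x ∈ Zᶜ, Q x * H x ≤ E :=
    Finset.sum_le_sum_of_subset_of_nonneg (Finset.subset_univ _)
      fun x _ _ => mul_nonneg (hQ x) (hH x)
  rw [← Finset.sum_mul] at hlt
  have : E ≤ (∑ x ∈ Zᶜ, Q x) * (ρ * E) := by
    calc E ≤ (ρ * (1 - κ * Z.card)) * E := by nlinarith
      _ = (1 - κ * Z.card) * (ρ * E) := by ring
      _ ≤ _ := mul_le_mul_of_nonneg_right hc (by positivity)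
  linarith

open Classical in
theorem card_filter_subtype_univ {V : Type*} (U : Finset V) (P : V → Prop) :
    (Finset.univ.filter fun x : U => P x).card = (U.filter P).card := by
  rw [← Finset.card_map (Function.Embedding.subtype _)]
  congr 1
  ext x
  simp only [Finset.mem_map, Finset.mem_filter, Finset.mem_univ, true_and,
    Function.Embedding.coe_subtype, Subtype.exists, exists_and_right, exists_eq_right]
  constructor
  · rintro ⟨h, h'⟩; exact ⟨h, h'⟩
  · rintro ⟨h, h'⟩; exact ⟨h, h'⟩

open Classical in
/-- A relation which is dense on the finite set `U` carries a doubly stochastic kernel on `U`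
with small entries. -/
theorem exists_doubly_stochastic_kernel {V : Type*} [Fintype V] (rel : V → V → Prop)
    (U : Finset V) (r : ℕ) (hr : 0 < r)
    (hrow : ∀ a ∈ U, U.card + 2 * r ≤ 2 * (U.filter fun x => rel a x).card)
    (hcol : ∀ x ∈ U, U.card + 2 * r ≤ 2 * (U.filter fun a => rel a x).card) :
    ∃ w : V → V → ℝ, (∀ a x, 0 ≤ w a x) ∧ (∀ a x, w a x ≤ 1 / r) ∧
      (∀ a x, w a x ≠ 0 → x ∈ U ∧ rel a x) ∧ (∀ a ∈ U, ∑ x, w a x = 1) ∧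
      (∀ x, ∑ a, w a x = if x ∈ U then 1 else 0) := by
  obtain ⟨reg, hsub, hreg, hreg'⟩ := exists_regular_subrelation (ι := U)
    (fun a x => rel a x) r
    (fun a => by
      have := hrow a a.2
      rw [← card_filter_subtype_univ] at this
      simpa using this)
    (fun x => by
      have := hcol x x.2
      rw [← card_filter_subtype_univ] at this
      simpa using this)
  have hr' : (0 : ℝ) < r := by exact_mod_cast hr
  let E : V → V → Prop := fun a x => ∃ (ha : a ∈ U) (hx : x ∈ U), reg ⟨a, ha⟩ ⟨x, hx⟩
  have hE1 : ∀ a ∈ U, (Finset.univ.filter fun x => E a x).card = r := by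
    intro a ha
    rw [← hreg ⟨a, ha⟩, ← Finset.card_map (Function.Embedding.subtype _)]
    congr 1
    ext x
    simp [E, ha]
  have hE2 : ∀ x ∈ U, (Finset.univ.filter fun a => E a x).card = r := by
    intro x hx
    rw [← hreg' ⟨x, hx⟩, ← Finset.card_map (Function.Embedding.subtype _)]
    congr 1
    ext a
    simp [E, hx]
  refine ⟨fun a x => if E a x then 1 / r else 0, ?_, ?_, ?_, ?_, ?_⟩
  · intro a x; dsimp only; split_ifs <;> positivity
  · intro a x; dsimp only; split_ifs
    · exact le_rfl
    · positivity
  · intro a x h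
    have hE : E a x := by
      by_contra h'
      simp [h'] at h
    obtain ⟨ha, hx, h3⟩ := hE
    exact ⟨hx, hsub _ _ h3⟩
  · intro a ha
    rw [← Finset.sum_filter, Finset.sum_const, hE1 a ha]
    simp [hr'.ne']
  · intro x
    rw [← Finset.sum_filter, Finset.sum_const]
    split_ifs with hx
    · rw [hE2 x hx]; simp [hr'.ne']
    · have : (Finset.univ.filter fun a => E a x) = ∅ := by
        ext a; simp [E, hx]
      rw [this]; simp

open Classical in
/-- A dense relation on `U` contains the graph of a permutation of `U`. -/
theorem exists_perm_of_half_degree_on {V : Type*} (rel : V → V → Prop)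
    (U : Finset V)
    (hrow : ∀ a ∈ U, U.card ≤ 2 * (U.filter fun x => rel a x).card)
    (hcol : ∀ x ∈ U, U.card ≤ 2 * (U.filter fun a => rel a x).card) :
    ∃ τ : Equiv.Perm V, (∀ x, τ x ∈ U ↔ x ∈ U) ∧ ∀ x ∈ U, rel x (τ x) := by
  obtain ⟨σ, hσ⟩ := exists_perm_of_half_degree (ι := U) (fun a x => rel a x)
    (fun a => by
      have := hrow a a.2
      rw [← card_filter_subtype_univ] at this
      simpa using this)
    (fun x => by
      have := hcol x x.2
      rw [← card_filter_subtype_univ] at this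
      simpa using this)
  have hmem : ∀ x (hx : x ∈ U), Equiv.Perm.ofSubtype σ x = σ ⟨x, hx⟩ := fun x hx =>
    Equiv.Perm.ofSubtype_apply_of_mem σ hx
  refine ⟨Equiv.Perm.ofSubtype σ, fun x => ?_, fun x hx => ?_⟩
  · by_cases hx : x ∈ U
    · rw [hmem x hx]; simp [hx]
    · rw [Equiv.Perm.ofSubtype_apply_of_not_mem σ hx]
  · rw [hmem x hx]; exact hσ ⟨x, hx⟩

/-! ### Laws for a top vertex that make its children uniform. -/

open Classical in
/-- In a relation dense towards `U`, for every `x` more than half of the `y ∈ U` have many common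
neighbours with `x` inside a given more than half of `U`. -/
theorem card_le_two_mul_card_many_common {V : Type*} (E G : V → V → Prop) (U A : Finset V)
    (β : ℝ) (hβ : 0 < β) (hAU : A ⊆ U) (hA : (1 / 2 + β) * U.card ≤ A.card)
    (hE : ∀ x, (1 / 2 + β) * U.card ≤ (U.filter fun a => E x a).card)
    (hG : ∀ a, (1 / 2 + β) * U.card ≤ (U.filter fun y => G a y).card) (x : V) :
    U.card ≤ 2 * (U.filter fun y =>
      β ^ 2 * U.card ≤ ((A.filter fun a => E x a ∧ G a y).card : ℝ)).card := by
  set N : ℝ := (U.card : ℝ) with hN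
  rcases Nat.eq_zero_or_pos U.card with h0 | hpos
  · omega
  have hNpos : 0 < N := by rw [hN]; exact_mod_cast hpos
  set B := A.filter fun a => E x a with hB
  set M : ℝ := (B.card : ℝ) with hM
  have hMl : 2 * β * N ≤ M := by
    have h1 : (A ∪ U.filter fun a => E x a).card ≤ U.card :=
      Finset.card_le_card (Finset.union_subset hAU (Finset.filter_subset _ _))
    have h2 := Finset.card_union_add_card_inter A (U.filter fun a => E x a)
    have h3 : A ∩ (U.filter fun a => E x a) = B := by
      ext a
      simp only [hB, Finset.mem_inter, Finset.mem_filter]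
      exact ⟨fun h => ⟨h.1, h.2.2⟩, fun h => ⟨h.1, hAU h.1, h.2⟩⟩
    rw [h3] at h2
    have h1' : ((A ∪ U.filter fun a => E x a).card : ℝ) ≤ N := by rw [hN]; exact_mod_cast h1
    have h2' : ((A ∪ U.filter fun a => E x a).card : ℝ) + M =
        A.card + (U.filter fun a => E x a).card := by rw [hM]; exact_mod_cast h2
    have := hE x
    linarith
  have hMpos : 0 < M := lt_of_lt_of_le (by positivity) hMl
  set cnt : V → ℝ := fun y => ((A.filter fun a => E x a ∧ G a y).card : ℝ) with hcnt
  have hcntM : ∀ y, cnt y ≤ M := by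
    intro y
    have : (A.filter fun a => E x a ∧ G a y) ⊆ B := by
      intro a; simp only [hB, Finset.mem_filter]; tauto
    show ((A.filter fun a => E x a ∧ G a y).card : ℝ) ≤ B.card
    exact_mod_cast Finset.card_le_card this
  have hsum : ∑ y ∈ U, cnt y = ∑ a ∈ B, ((U.filter fun y => G a y).card : ℝ) := by
    have h1 : ∀ y, cnt y = ∑ a ∈ B, if G a y then (1 : ℝ) else 0 := by
      intro y
      rw [Finset.sum_boole, hB, Finset.filter_filter]
    have h2 : ∀ a, ((U.filter fun y => G a y).card : ℝ) = ∑ y ∈ U, if G a y then (1 : ℝ) else 0 := by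
      intro a
      rw [Finset.sum_boole]
    simp_rw [h1, h2]
    exact Finset.sum_comm
  have hlow : M * ((1 / 2 + β) * N) ≤ ∑ y ∈ U, cnt y := by
    rw [hsum]
    calc _ = ∑ a ∈ B, ((1 / 2 + β) * N) := by simp [hM]
      _ ≤ _ := Finset.sum_le_sum fun a _ => hG a
  -- The `y` with few common neighbours account for at most `β/2 * N * M` of the at least `(1/2 + β)
  -- * N * M` incidences; any other `y` accounts for at most `M`, so there are at least `(1/2 + β/2)
  -- * N` of these.
  set S := U.filter fun y => β ^ 2 * N ≤ cnt y with hS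
  have hup : ∑ y ∈ U, cnt y ≤ S.card * M + N * (β ^ 2 * N) := by
    rw [← Finset.sum_filter_add_sum_filter_not U (fun y => β ^ 2 * N ≤ cnt y)]
    apply add_le_add
    · calc _ ≤ ∑ y ∈ S, M := Finset.sum_le_sum fun y _ => hcntM y
        _ = _ := by simp
    · calc _ ≤ ∑ y ∈ U.filter fun y => ¬ β ^ 2 * N ≤ cnt y, β ^ 2 * N :=
            Finset.sum_le_sum fun y hy => by
              have := (Finset.mem_filter.1 hy).2
              exact (not_le.1 this).le
        _ = ((U.filter fun y => ¬ β ^ 2 * N ≤ cnt y).card : ℝ) * (β ^ 2 * N) := by simp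
        _ ≤ _ := by
          apply mul_le_mul_of_nonneg_right _ (by positivity)
          rw [hN]
          exact_mod_cast Finset.card_le_card (Finset.filter_subset _ _)
  have h5 : N * (β ^ 2 * N) ≤ (β / 2 * N) * M := by
    have : 0 ≤ β / 2 * N := by positivity
    nlinarith [mul_le_mul_of_nonneg_left hMl this]
  have h6 : ((1 / 2 + β) * N - β / 2 * N) * M ≤ S.card * M := by linarith
  have h7 := le_of_mul_le_mul_right h6 hMpos
  have h8 : N ≤ 2 * S.card := by nlinarith
  rw [hN] at h8
  exact_mod_cast h8

open Classical in
/-- For a dense set `A` of possible positions of a vertex there is a distribution on `A` and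
kernels in both directions which make the neighbours exactly uniform on `U`. -/
theorem exists_uniformizing_kernels {V : Type*} [Fintype V] (R : Bool → V → V → Prop)
    (hR : ∀ b a x, R b a x ↔ R (!b) x a) (U A : Finset V) (β ζ : ℝ) (hβ : 0 < β) (hζ : 0 < ζ)
    (hU : U.Nonempty) (hAU : A ⊆ U) (hA : (1 / 2 + β) * U.card ≤ A.card)
    (hdeg : ∀ b u, (1 / 2 + β) * U.card ≤ (U.filter fun x => R b u x).card) :
    ∃ (p : V → ℝ) (K : Bool → V → V → ℝ), (∀ a, 0 ≤ p a) ∧ (∀ a, p a ≠ 0 → a ∈ A) ∧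
      ∑ a, p a = 1 ∧ (∀ b a x, 0 ≤ K b a x) ∧ (∀ b a x, K b a x ≠ 0 → x ∈ U ∧ R b a x) ∧
      (∀ b x, ∑ a, p a * K b a x = if x ∈ U then 1 / (U.card : ℝ) else 0) ∧
      (∀ b a, p a ≠ 0 → ∑ x, K b a x = 1) ∧
      (∀ b a x, ζ / U.card ≤ p a → K b a x ≤ 1 / (β ^ 2 * ζ * U.card)) := by
  have hNpos : (0 : ℝ) < U.card := by exact_mod_cast hU.card_pos
  obtain ⟨N, hN⟩ : ∃ N : ℝ, N = U.card := ⟨_, rfl⟩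
  rw [← hN] at hA hNpos ⊢
  simp only [← hN] at hdeg
  -- Forward and backward children are coupled: each `x` is paired with `τ x` so that many `a ∈ A`
  -- serve both as forward child `x` and backward child `τ x`. Both children are uniform if `x` is,
  -- since `τ` permutes `U`.
  obtain ⟨τ, hτU, hτ⟩ := exists_perm_of_half_degree_on
    (fun x y => β ^ 2 * N ≤ ((A.filter fun a => R true a x ∧ R false a y).card : ℝ)) U
    (fun x _ => by
      have := card_le_two_mul_card_many_common (fun x a => R false x a) (fun a y => R false a y)
        U A β hβ hAU (hN ▸ hA) (hN ▸ hdeg false) (hN ▸ hdeg false) x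
      simp only [hR false x, Bool.not_false, ← hN] at this
      exact this)
    (fun y _ => by
      have := card_le_two_mul_card_many_common (fun x a => R true x a) (fun a y => R true a y)
        U A β hβ hAU (hN ▸ hA) (hN ▸ hdeg true) (hN ▸ hdeg true) y
      simp only [hR true y, Bool.not_true, ← hN] at this
      simpa only [and_comm] using this)
  obtain ⟨As, hAs⟩ : ∃ As : V → Finset V,
      ∀ x, As x = A.filter fun a => R true a x ∧ R false a (τ x) := ⟨_, fun _ => rfl⟩
  have hAsc : ∀ x ∈ U, β ^ 2 * N ≤ ((As x).card : ℝ) := fun x hx => by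
    rw [hAs]; exact hτ x hx
  have hAs' : ∀ x a, a ∈ As x → a ∈ A ∧ R true a x ∧ R false a (τ x) := fun x a h => by
    rw [hAs] at h; exact Finset.mem_filter.1 h
  clear hτ hAs hR
  have hAspos : ∀ x ∈ U, (0 : ℝ) < (As x).card := fun x hx =>
    lt_of_lt_of_le (by positivity) (hAsc x hx)
  -- `P` is the joint law of `(a, x)` for `x` uniform on `U` and then `a` uniform on `As x`; its
  -- marginal `p` in `a` need not be uniform.
  obtain ⟨P, hP⟩ : ∃ P : V → V → ℝ, ∀ a x,
      P a x = if x ∈ U ∧ a ∈ As x then 1 / (N * (As x).card) else 0 := ⟨_, fun _ _ => rfl⟩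
  have hP0 : ∀ a x, 0 ≤ P a x := by
    intro a x; rw [hP]; split_ifs <;> positivity
  have hPsupp : ∀ a x, P a x ≠ 0 → x ∈ U ∧ a ∈ As x := by
    intro a x h
    by_contra h'
    exact h (by rw [hP, if_neg h'])
  have hPle : ∀ a x, P a x ≤ 1 / (N * (β ^ 2 * N)) := by
    intro a x
    rw [hP]
    split_ifs with h
    · apply one_div_le_one_div_of_le (by positivity)
      exact mul_le_mul_of_nonneg_left (hAsc x h.1) hNpos.le
    · positivity
  have hPcol : ∀ x, ∑ a, P a x = if x ∈ U then 1 / N else 0 := by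
    intro x
    by_cases hx : x ∈ U
    · simp only [hP, hx, true_and, if_true]
      rw [← Finset.sum_filter, Finset.sum_const, Finset.filter_mem_eq_inter, Finset.univ_inter]
      have := hAspos x hx
      rw [nsmul_eq_mul]
      field_simp
    · simp [hP, hx]
  obtain ⟨p, hp⟩ : ∃ p : V → ℝ, ∀ a, p a = ∑ x, P a x := ⟨_, fun _ => rfl⟩
  have hp0 : ∀ a, 0 ≤ p a := fun a => hp a ▸ Finset.sum_nonneg fun x _ => hP0 a x
  have hPp : ∀ a x, P a x ≤ p a := fun a x => hp a ▸
    Finset.single_le_sum (f := fun x => P a x) (fun x _ => hP0 a x) (Finset.mem_univ x)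
  -- The backward child sits at `τ x`, so its kernel evaluates `P` at the preimage under `τ`.
  obtain ⟨g, hg⟩ : ∃ g : Bool → V → V, ∀ b x, g b x = if b then x else τ.symm x :=
    ⟨_, fun _ _ => rfl⟩
  have hgU : ∀ b x, g b x ∈ U ↔ x ∈ U := by
    intro b x
    cases b
    · simp only [hg, Bool.false_eq_true, if_false]
      rw [← hτU]; simp
    · simp [hg]
  have hgsum : ∀ b a, ∑ x, P a (g b x) = p a := by
    intro b a
    cases b
    · simp only [hg, Bool.false_eq_true, if_false]
      rw [hp]; exact Equiv.sum_comp τ.symm (fun x => P a x)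
    · simp [hg, hp]
  refine ⟨p, fun b a x => P a (g b x) / p a, hp0, ?_, ?_, ?_, ?_, ?_, ?_, ?_⟩
  · intro a ha
    rw [hp] at ha
    obtain ⟨x, -, hx⟩ := Finset.exists_ne_zero_of_sum_ne_zero ha
    exact (hAs' _ _ (hPsupp a x hx).2).1
  · simp only [hp]
    rw [Finset.sum_comm]
    simp_rw [hPcol]
    rw [← Finset.sum_filter, Finset.sum_const, Finset.filter_mem_eq_inter, Finset.univ_inter,
      nsmul_eq_mul]
    rw [← hN]
    field_simp
  · intro b a x; exact div_nonneg (hP0 _ _) (hp0 _)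
  · intro b a x h
    have h1 : P a (g b x) ≠ 0 := fun h0 => h (by simp [h0])
    obtain ⟨h2, h3⟩ := hPsupp _ _ h1
    refine ⟨(hgU b x).1 h2, ?_⟩
    have h4 := (hAs' _ _ h3).2
    cases b
    · simpa [hg] using h4.2
    · simpa [hg] using h4.1
  · intro b x
    have : ∀ a, p a * (P a (g b x) / p a) = P a (g b x) := by
      intro a
      rcases eq_or_ne (p a) 0 with h | h
      · have h1 := hPp a (g b x)
        have h2 := hP0 a (g b x)
        rw [h]; linarith
      · field_simp
    simp_rw [this, hPcol, hgU]
  · intro b a ha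
    rw [← Finset.sum_div, hgsum, div_self ha]
  · intro b a x ha
    have hpa : 0 < p a := lt_of_lt_of_le (by positivity) ha
    calc P a (g b x) / p a ≤ (1 / (N * (β ^ 2 * N))) / (ζ / N) :=
          div_le_div₀ (by positivity) (hPle _ _) (by positivity) ha
      _ = _ := by field_simp

/-! ### Placing one piece by conditional expectations. -/

/-- Greedy placement of a rooted tree: if every vertex can be placed, given the position of its
parent and avoiding few forbidden points, at a point where a given nonnegative function is at most
`ρ` times its mean, then the tree has an injective placement of total cost at most what one gets
from the marginals `μ`, up to the powers of `ρ`. -/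
theorem exists_tree_placement {V W : Type*} [Fintype V] (par : W → W) (e d : W → ℕ) (r : W)
    (m : ℕ) (Good : W → Set V) (Rel : W → V → V → Prop) (μ : W → V → ℝ) (Q : W → V → V → ℝ)
    (ρ₀ ρ : ℝ) (hρ₀ : 0 ≤ ρ₀) (hρ : 0 ≤ ρ) (hQ : ∀ i a x, 0 ≤ Q i a x)
    (hroot : ∀ H : V → ℝ, (∀ x, 0 ≤ H x) → ∃ a ∈ Good r, H a ≤ ρ₀ * ∑ x, μ r x * H x)
    (n : ℕ) (C : Finset W) (hn : C.card = n) (hCm : C.card ≤ m) (hr : r ∈ C) (hdr : d r = 0)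
    (hpar : ∀ i ∈ C, i ≠ r → par i ∈ C ∧ e (par i) < e i ∧ d i = d (par i) + 1)
    (hstep : ∀ i ∈ C, i ≠ r → ∀ a ∈ Good (par i), ∀ H : V → ℝ, (∀ x, 0 ≤ H x) →
      ∀ Z : Finset V, Z.card ≤ m → ∃ x ∈ Good i, x ∉ Z ∧ Rel i a x ∧ H x ≤ ρ * ∑ x, Q i a x * H x)
    (hmarg : ∀ i ∈ C, i ≠ r → ∀ x, ∑ a, μ (par i) a * Q i a x ≤ μ i x)
    (F : W → V → ℝ) (hF : ∀ i x, 0 ≤ F i x) :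
    ∃ φ : W → V, (∀ i ∈ C, φ i ∈ Good i) ∧ Set.InjOn φ C ∧
      (∀ i ∈ C, i ≠ r → Rel i (φ (par i)) (φ i)) ∧
      ∑ i ∈ C, F i (φ i) ≤ ρ₀ * ∑ i ∈ C, ρ ^ d i * ∑ x, μ i x * F i x := by
  classical
  induction n generalizing C F with
  | zero => rw [Finset.card_eq_zero] at hn; simp [hn] at hr
  | succ n ih =>
  rcases (C.erase r).eq_empty_or_nonempty with hemp | hne
  · have hC : C = {r} := by
      rw [← Finset.insert_erase hr, hemp]; rfl
    obtain ⟨a, ha, ha'⟩ := hroot (F r) (hF r)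
    refine ⟨fun _ => a, ?_, ?_, ?_, ?_⟩
    · simp [hC, ha]
    · simp [hC]
    · intro i hi hir; simp [hC] at hi; exact absurd hi hir
    · simpa [hC, hdr] using ha'
  obtain ⟨i, hi, hmax⟩ := Finset.exists_max_image (C.erase r) e hne
  obtain ⟨hir, hiC⟩ := Finset.mem_erase.1 hi
  obtain ⟨hpC, hpe, hpd⟩ := hpar i hiC hir
  have hpi : par i ≠ i := fun h => by rw [h] at hpe; exact lt_irrefl _ hpe
  -- `i` maximises `e`, so it is a leaf and is placed last. Its mean cost, as a function of the
  -- parent's position, is charged to the parent; this is why the cost function must depend on the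
  -- vertex.
  set G : V → ℝ := fun a => ρ * ∑ x, Q i a x * F i x with hG
  have hG0 : ∀ a, 0 ≤ G a := fun a =>
    mul_nonneg hρ (Finset.sum_nonneg fun x _ => mul_nonneg (hQ _ _ _) (hF _ _))
  have hnl : ∀ j ∈ C, j ≠ r → par j ≠ i := by
    intro j hj hjr h
    have h1 := (hpar j hj hjr).2.1
    have h2 := hmax j (Finset.mem_erase.2 ⟨hjr, hj⟩)
    rw [h] at h1
    omega
  have hsub : ∀ j ∈ C.erase i, j ∈ C := fun j hj => (Finset.mem_erase.1 hj).2
  obtain ⟨φ, hφg, hφi, hφr, hφc⟩ := ih (C.erase i)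
    (by rw [Finset.card_erase_of_mem hiC]; omega)
    ((Finset.card_erase_le).trans hCm) (Finset.mem_erase.2 ⟨hir.symm, hr⟩)
    (fun j hj hjr => by
      obtain ⟨h1, h2, h3⟩ := hpar j (hsub j hj) hjr
      exact ⟨Finset.mem_erase.2 ⟨hnl j (hsub j hj) hjr, h1⟩, h2, h3⟩)
    (fun j hj => hstep j (hsub j hj)) (fun j hj => hmarg j (hsub j hj))
    (fun j x => F j x + if j = par i then G x else 0)
    (fun j x => add_nonneg (hF j x) (by split_ifs; exacts [hG0 x, le_rfl]))
  have hpC' : par i ∈ C.erase i := Finset.mem_erase.2 ⟨hpi, hpC⟩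
  obtain ⟨x, hxg, hxZ, hxr, hxc⟩ := hstep i hiC hir (φ (par i)) (hφg _ hpC') (F i) (hF i)
    ((C.erase i).image φ) (Finset.card_image_le.trans (Finset.card_erase_le.trans hCm))
  have hupd : ∀ j ∈ C.erase i, Function.update φ i x j = φ j := fun j hj =>
    Function.update_of_ne (Finset.mem_erase.1 hj).1 _ _
  have hCi : insert i (C.erase i) = C := Finset.insert_erase hiC
  refine ⟨Function.update φ i x, ?_, ?_, ?_, ?_⟩
  · intro j hj
    rcases eq_or_ne j i with rfl | hji
    · simpa using hxg
    · have hj' := Finset.mem_erase.2 ⟨hji, hj⟩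
      rw [hupd j hj']; exact hφg j hj'
  · intro j hj k hk hjk
    rcases eq_or_ne j i with hji | hji <;> rcases eq_or_ne k i with hki | hki
    · rw [hji, hki]
    · have hk' := Finset.mem_erase.2 ⟨hki, hk⟩
      rw [hupd k hk', hji, Function.update_self] at hjk
      exact absurd (Finset.mem_image.2 ⟨k, hk', hjk.symm⟩) hxZ
    · have hj' := Finset.mem_erase.2 ⟨hji, hj⟩
      rw [hupd j hj', hki, Function.update_self] at hjk
      exact absurd (Finset.mem_image.2 ⟨j, hj', hjk⟩) hxZ
    · have hk' := Finset.mem_erase.2 ⟨hki, hk⟩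
      have hj' := Finset.mem_erase.2 ⟨hji, hj⟩
      rw [hupd k hk', hupd j hj'] at hjk
      exact hφi hj' hk' hjk
  · intro j hj hjr
    have h1 : Function.update φ i x (par j) = φ (par j) :=
      Function.update_of_ne (hnl j hj hjr) _ _
    rw [h1]
    rcases eq_or_ne j i with rfl | hji
    · simpa using hxr
    · have hj' := Finset.mem_erase.2 ⟨hji, hj⟩
      rw [hupd j hj']; exact hφr j hj' hjr
  · rw [← Finset.add_sum_erase C _ hiC, ← Finset.add_sum_erase C (fun i => ρ ^ d i * _) hiC,
      Function.update_self, Finset.sum_congr rfl fun j hj => by rw [hupd j hj]]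
    have e1 : ∑ j ∈ C.erase i, (F j (φ j) + if j = par i then G (φ j) else 0) =
        ∑ j ∈ C.erase i, F j (φ j) + G (φ (par i)) := by
      rw [Finset.sum_add_distrib, Finset.sum_ite_eq_of_mem' _ _ _ hpC']
    have e2 : ∑ j ∈ C.erase i, ρ ^ d j * ∑ x, μ j x * (F j x + if j = par i then G x else 0) =
        ∑ j ∈ C.erase i, ρ ^ d j * ∑ x, μ j x * F j x +
          ρ ^ d (par i) * ∑ a, μ (par i) a * G a := by
      have : ∀ j, ρ ^ d j * ∑ x, μ j x * (F j x + if j = par i then G x else 0) =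
          ρ ^ d j * ∑ x, μ j x * F j x +
            if j = par i then ρ ^ d j * ∑ a, μ j a * G a else 0 := by
        intro j
        split_ifs <;> simp [mul_add, Finset.sum_add_distrib]
      simp_rw [this]
      rw [Finset.sum_add_distrib, Finset.sum_ite_eq_of_mem' _ _ _ hpC']
    rw [e1, e2] at hφc
    -- The factor `ρ` in `G` lifts the exponent from the depth of the parent to that of `i`, and
    -- `hmarg` converts the parent's marginal into that of `i`.
    have e3 : ρ ^ d (par i) * ∑ a, μ (par i) a * G a ≤ ρ ^ d i * ∑ x, μ i x * F i x := by
      have : ∑ a, μ (par i) a * G a =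
          ρ * ∑ x, (∑ a, μ (par i) a * Q i a x) * F i x := by
        simp only [hG, Finset.mul_sum, Finset.sum_mul]
        rw [Finset.sum_comm]
        exact Finset.sum_congr rfl fun x _ => Finset.sum_congr rfl fun a _ => by ring
      rw [this, hpd, pow_succ, mul_assoc]
      apply mul_le_mul_of_nonneg_left _ (pow_nonneg hρ _)
      apply mul_le_mul_of_nonneg_left _ hρ
      exact Finset.sum_le_sum fun x _ =>
        mul_le_mul_of_nonneg_right (hmarg i hiC hir x) (hF i x)
    have e4 := mul_le_mul_of_nonneg_left e3 hρ₀
    have e5 : F i x ≤ G (φ (par i)) := hxc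
    rw [mul_add] at hφc ⊢
    linarith

open Classical in
/-- Embedding one small tree of bounded height into the unused set `U`, with its root attached to
a given vertex `q`, so that the total cost is about what uniformly distributed positions give. -/
theorem exists_tree_embedding_of_dense {V W : Type*} [Fintype V] (R : Bool → V → V → Prop)
    (hR : ∀ b a x, R b a x ↔ R (!b) x a) (U : Finset V) (hU : U.Nonempty) (β ζ κ ρ : ℝ)
    (hβ : 0 < β) (hζ : 0 < ζ) (hζ1 : ζ < 1) (s m L : ℕ) (hs : 0 < s) (hsβ : (s : ℝ) ≤ β * U.card)
    (hdeg : ∀ b u, (1 / 2 + β) * U.card ≤ (U.filter fun x => R b u x).card)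
    (hκ1 : 1 / (s : ℝ) ≤ κ) (hκ2 : 1 / (β ^ 2 * ζ * U.card) ≤ κ) (hρ0 : 0 ≤ ρ)
    (hρ : 1 ≤ ρ * (1 - κ * m))
    (par : W → W) (e d : W → ℕ) (o : W → Bool) (r : W) (C : Finset W) (hCm : C.card ≤ m)
    (hr : r ∈ C) (hdr : d r = 0)
    (hpar : ∀ i ∈ C, i ≠ r → par i ∈ C ∧ e (par i) < e i ∧ d i = d (par i) + 1)
    (hL : ∀ i ∈ C, d i ≤ L) (q : V) (F : V → ℝ) (M : ℝ) (hF : ∀ x, 0 ≤ F x)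
    (hFM : ∀ x, F x ≤ M) :
    ∃ φ : W → V, (∀ i ∈ C, φ i ∈ U) ∧ Set.InjOn φ C ∧
      (∀ i ∈ C, i ≠ r → R (o i) (φ (par i)) (φ i)) ∧ R (o r) q (φ r) ∧
      ∑ i ∈ C, F (φ i) ≤ 1 / (1 - ζ) * (M + ρ ^ L * (C.card * ((∑ x ∈ U, F x) / U.card))) := by
  have hNpos : (0 : ℝ) < U.card := by exact_mod_cast hU.card_pos
  set A := U.filter fun x => R (o r) q x with hA
  obtain ⟨p, K, hp0, hpA, hp1, hK0, hKs, hKm, hK1, hKκ⟩ :=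
    exists_uniformizing_kernels R hR U A β ζ hβ hζ hU (Finset.filter_subset _ _) (hdeg _ _) hdeg
  have hdegN : ∀ b u, U.card + 2 * s ≤ 2 * (U.filter fun x => R b u x).card := by
    intro b u
    have := hdeg b u
    have h : (U.card + 2 * s : ℝ) ≤ 2 * (U.filter fun x => R b u x).card := by linarith
    exact_mod_cast h
  have hw : ∀ b, ∃ w : V → V → ℝ, (∀ a x, 0 ≤ w a x) ∧ (∀ a x, w a x ≤ 1 / s) ∧
      (∀ a x, w a x ≠ 0 → x ∈ U ∧ R b a x) ∧ (∀ a ∈ U, ∑ x, w a x = 1) ∧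
      (∀ x, ∑ a, w a x = if x ∈ U then 1 else 0) := fun b =>
    exists_doubly_stochastic_kernel (R b) U s hs (fun a _ => hdegN b a) (fun x _ => by
      have := hdegN (!b) x
      simpa only [← hR b] using this)
  choose w hw0 hwκ hws hw1 hwm using hw
  clear hR
  have hκ0 : 0 ≤ κ := le_trans (by positivity) hκ1
  have hρ1 : 1 ≤ ρ := by
    have : 0 ≤ ρ * (κ * m) := by positivity
    nlinarith
  -- Positions with `p` below `ζ / U.card` are excluded because the bound on `K` is unavailable
  -- there. At most `U.card` of them lie in `A`, with mass at most `ζ`, whence the factor `1 / (1 -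
  -- ζ)`.
  have hroot : ∀ H : V → ℝ, (∀ x, 0 ≤ H x) →
      ∃ a ∈ {a : V | a ∈ A ∧ ζ / U.card ≤ p a}, H a ≤ 1 / (1 - ζ) * ∑ x, p x * H x := by
    intro H hH
    by_contra! hcon
    set G := Finset.univ.filter fun a => a ∈ A ∧ ζ / U.card ≤ p a with hG
    have hbad : ∑ a ∈ Gᶜ, p a ≤ ζ := by
      have h1 : ∑ a ∈ Gᶜ, p a = ∑ a ∈ Gᶜ.filter (· ∈ A), p a := by
        rw [Finset.sum_filter]
        refine Finset.sum_congr rfl fun a _ => ?_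
        split_ifs with h
        · rfl
        · by_contra h'
          exact h (hpA a h')
      rw [h1]
      calc ∑ a ∈ Gᶜ.filter (· ∈ A), p a ≤ ∑ a ∈ Gᶜ.filter (· ∈ A), ζ / U.card := by
            refine Finset.sum_le_sum fun a ha => ?_
            rw [Finset.mem_filter, Finset.mem_compl, hG, Finset.mem_filter] at ha
            by_contra h
            exact ha.1 ⟨Finset.mem_univ _, ha.2, (not_le.1 h).le⟩
        _ = ((Gᶜ.filter (· ∈ A)).card : ℝ) * (ζ / U.card) := by simp
        _ ≤ U.card * (ζ / U.card) := by
            apply mul_le_mul_of_nonneg_right _ (by positivity)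
            have : Gᶜ.filter (· ∈ A) ⊆ U := fun a ha =>
              (Finset.mem_filter.1 (Finset.mem_filter.1 ha).2).1
            exact_mod_cast Finset.card_le_card this
        _ = ζ := by field_simp
    have hgood : 1 - ζ ≤ ∑ a ∈ G, p a := by
      have := Finset.sum_compl_add_sum G p
      linarith
    have hne : G.Nonempty := by
      by_contra h
      rw [Finset.not_nonempty_iff_eq_empty] at h
      rw [h, Finset.sum_empty] at hgood
      linarith
    set E := ∑ x, p x * H x with hE
    have hE0 : 0 ≤ E := Finset.sum_nonneg fun x _ => mul_nonneg (hp0 x) (hH x)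
    have hlt : ∑ a ∈ G, p a * (1 / (1 - ζ) * E) < ∑ a ∈ G, p a * H a := by
      apply Finset.sum_lt_sum_of_nonempty hne
      intro a ha
      have ha' := (Finset.mem_filter.1 ha).2
      have : 0 < p a := lt_of_lt_of_le (by positivity) ha'.2
      exact mul_lt_mul_of_pos_left (hcon a ha') this
    have hle : ∑ a ∈ G, p a * H a ≤ E :=
      Finset.sum_le_sum_of_subset_of_nonneg (Finset.subset_univ _)
        fun x _ _ => mul_nonneg (hp0 x) (hH x)
    rw [← Finset.sum_mul] at hlt
    have h1 : (1 - ζ) * (1 / (1 - ζ) * E) ≤ (∑ a ∈ G, p a) * (1 / (1 - ζ) * E) :=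
      mul_le_mul_of_nonneg_right hgood
        (mul_nonneg (one_div_nonneg.2 (by linarith)) hE0)
    have h2 : (1 - ζ) * (1 / (1 - ζ) * E) = E := by
      have : 1 - ζ ≠ 0 := by linarith
      field_simp
    linarith
  have hρZ : ∀ Z : Finset V, Z.card ≤ m → 1 ≤ ρ * (1 - κ * Z.card) := by
    intro Z hZ
    have h1 : (Z.card : ℝ) ≤ m := by exact_mod_cast hZ
    have h2 : κ * Z.card ≤ κ * m := mul_le_mul_of_nonneg_left h1 hκ0
    have := mul_le_mul_of_nonneg_left (sub_le_sub_left h2 1) hρ0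
    linarith
  -- The top has law `p`, its children follow `K`, deeper vertices follow `w`; all marginals except
  -- that of the top are uniform on `U`.
  obtain ⟨φ, hφg, hφi, hφR, hφc⟩ := exists_tree_placement par e d r m
    (fun i => if i = r then {a : V | a ∈ A ∧ ζ / U.card ≤ p a} else (U : Set V))
    (fun i a x => R (o i) a x)
    (fun i x => if i = r then p x else if x ∈ U then 1 / (U.card : ℝ) else 0)
    (fun i a x => if par i = r then K (o i) a x else w (o i) a x)
    (1 / (1 - ζ)) ρ (one_div_nonneg.2 (by linarith)) hρ0
    (fun i a x => by split_ifs; exacts [hK0 _ _ _, hw0 _ _ _])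
    (by simpa using hroot) C.card C rfl hCm hr hdr hpar
    (by
      intro i hi hir a ha H hH Z hZ
      simp only [hir, if_false]
      by_cases hpr : par i = r
      · simp only [hpr, if_true] at ha ⊢
        have hpa : p a ≠ 0 := (lt_of_lt_of_le (by positivity) ha.2).ne'
        obtain ⟨x, h1, h2, h3⟩ := exists_le_mean_avoiding (K (o i) a) H Z κ ρ (hK0 _ _)
          (fun x => (hKκ _ _ _ ha.2).trans hκ2) (hK1 _ _ hpa) hH hρ0 (hρZ Z hZ)
        exact ⟨x, (hKs _ _ _ h2.ne').1, h1, (hKs _ _ _ h2.ne').2, h3⟩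
      · simp only [hpr, if_false] at ha ⊢
        obtain ⟨x, h1, h2, h3⟩ := exists_le_mean_avoiding (w (o i) a) H Z κ ρ (hw0 _ _)
          (fun x => (hwκ _ _ _).trans hκ1) (hw1 _ _ ha) hH hρ0 (hρZ Z hZ)
        exact ⟨x, (hws _ _ _ h2.ne').1, h1, (hws _ _ _ h2.ne').2, h3⟩)
    (by
      intro i hi hir x
      simp only [hir, if_false]
      by_cases hpr : par i = r
      · simp only [hpr, if_true, hKm]
        exact le_rfl
      · simp only [hpr, if_false]
        calc ∑ a, (if a ∈ U then 1 / (U.card : ℝ) else 0) * w (o i) a x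
            ≤ ∑ a, 1 / (U.card : ℝ) * w (o i) a x := by
              refine Finset.sum_le_sum fun a _ => mul_le_mul_of_nonneg_right ?_ (hw0 _ _ _)
              split_ifs
              · exact le_rfl
              · positivity
          _ = _ := by
              rw [← Finset.mul_sum, hwm]
              split_ifs <;> simp)
    (fun _ => F) (fun _ => hF)
  refine ⟨φ, ?_, hφi, hφR, ?_, hφc.trans ?_⟩
  · intro i hi
    have := hφg i hi
    by_cases h : i = r
    · simp only [h, if_true] at this ⊢
      exact (Finset.mem_filter.1 this.1).1
    · simpa [h] using this
  · have := hφg r hr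
    simp only [if_true] at this
    exact (Finset.mem_filter.1 this.1).2
  · apply mul_le_mul_of_nonneg_left _ (one_div_nonneg.2 (by linarith))
    rw [← Finset.add_sum_erase C _ hr]
    apply add_le_add
    -- The top is not uniform, so its cost is bounded by the maximum `M`, once per piece.
    · simp only [hdr, pow_zero, one_mul, if_true]
      calc ∑ x, p x * F x ≤ ∑ x, p x * M :=
            Finset.sum_le_sum fun x _ => mul_le_mul_of_nonneg_left (hFM x) (hp0 x)
        _ = M := by rw [← Finset.sum_mul, hp1, one_mul]
    · set a := (∑ x ∈ U, F x) / U.card with ha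
      have ha0 : 0 ≤ a := div_nonneg (Finset.sum_nonneg fun x _ => hF x) hNpos.le
      calc _ ≤ ∑ i ∈ C.erase r, ρ ^ L * a := by
            refine Finset.sum_le_sum fun i hi => ?_
            obtain ⟨hir, hiC⟩ := Finset.mem_erase.1 hi
            simp only [hir, if_false]
            have h1 : ∑ x, (if x ∈ U then 1 / (U.card : ℝ) else 0) * F x = a := by
              simp only [ite_mul, zero_mul]
              rw [← Finset.sum_filter, Finset.filter_mem_eq_inter, Finset.univ_inter,
                ← Finset.mul_sum, ha]
              ring
            rw [h1]
            exact mul_le_mul_of_nonneg_right (pow_le_pow_right₀ hρ1 (hL i hiC)) ha0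
        _ = (C.erase r).card * (ρ ^ L * a) := by simp
        _ ≤ C.card * (ρ ^ L * a) := by
            apply mul_le_mul_of_nonneg_right _ (by positivity)
            exact_mod_cast Finset.card_erase_le
        _ = _ := by ring

/-! ### The exponential potential. -/

open Classical in
/-- The proportion of the vertices of `U` that are neighbours of the vertex `j.2` in the
direction `j.1`. -/
noncomputable def nbrDensity {V : Type*} (R : Bool → V → V → Prop) (U : Finset V)
    (j : Bool × V) : ℝ :=
  ((U.filter fun x => R j.1 j.2 x).card : ℝ) / U.card

/-- An exponential potential which is small only if all neighbour densities in `U` are large. -/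
noncomputable def densityPotential {V : Type*} [Fintype V] (R : Bool → V → V → Prop) (l : ℝ)
    (U : Finset V) : ℝ :=
  ∑ j : Bool × V, Real.exp (-l * nbrDensity R U j)

section
variable {V : Type*} (R : Bool → V → V → Prop)

theorem nbrDensity_nonneg (U : Finset V) (j : Bool × V) : 0 ≤ nbrDensity R U j := by
  unfold nbrDensity; positivity

theorem nbrDensity_le_one (U : Finset V) (j : Bool × V) : nbrDensity R U j ≤ 1 := by
  classical
  unfold nbrDensity
  apply div_le_one_of_le₀ _ (by positivity)
  exact_mod_cast Finset.card_filter_le _ _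

theorem densityPotential_nonneg [Fintype V] (l : ℝ) (U : Finset V) :
    0 ≤ densityPotential R l U :=
  Finset.sum_nonneg fun _ _ => (Real.exp_pos _).le

/-- A single density of at most `γ` would already contribute `exp (-l * γ)`. This turns the scalar
invariant into a degree condition at every vertex in both directions. -/
theorem lt_nbrDensity_of_densityPotential_lt [Fintype V] {l γ : ℝ} (hl : 0 < l) {U : Finset V}
    (h : densityPotential R l U < Real.exp (-l * γ)) (j : Bool × V) : γ < nbrDensity R U j := by
  have h1 : Real.exp (-l * nbrDensity R U j) ≤ densityPotential R l U :=
    Finset.single_le_sum (f := fun j => Real.exp (-l * nbrDensity R U j))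
      (fun _ _ => (Real.exp_pos _).le) (Finset.mem_univ j)
  have h2 := Real.exp_lt_exp.1 (h1.trans_lt h)
  have h3 : l * γ < l * nbrDensity R U j := by linarith
  exact lt_of_mul_lt_mul_left h3 hl.le

open Classical in
/-- Removing a set `P` from `U` which meets the neighbourhoods about proportionally in weighted
average hardly increases the potential. -/
theorem densityPotential_sdiff_le [Fintype V] (l D g m : ℝ) (hl : 0 < l) (hD : 0 < D) (hg : 0 ≤ g)
    (U P : Finset V) (hPU : P ⊆ U) (hPm : (P.card : ℝ) ≤ m) (hm : l * m ≤ D)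
    (hUD : D ≤ (U.card : ℝ) - P.card)
    (hP : ∑ j : Bool × V, Real.exp (-l * nbrDensity R U j) * (P.filter fun x => R j.1 j.2 x).card ≤
      P.card * ∑ j : Bool × V, Real.exp (-l * nbrDensity R U j) * nbrDensity R U j +
        g * densityPotential R l U) :
    densityPotential R l (U \ P) ≤
      densityPotential R l U * (1 + l * g / D + l ^ 2 * m * P.card / D ^ 2) := by
  set u : ℝ := (U.card : ℝ) with hu
  set k : ℝ := (P.card : ℝ) with hk
  have hk0 : 0 ≤ k := by positivity
  have hu0 : 0 < u := by linarith
  have hD' : 0 < u - k := by linarith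
  set Y : Bool × V → ℝ := fun j => ((P.filter fun x => R j.1 j.2 x).card : ℝ) with hY
  set a : Bool × V → ℝ := fun j => Real.exp (-l * nbrDensity R U j) with ha
  have ha0 : ∀ j, 0 ≤ a j := fun j => (Real.exp_pos _).le
  have hYk : ∀ j, Y j ≤ k := fun j => by
    simp only [hY, hk]
    exact_mod_cast Finset.card_filter_le _ _
  have hY0 : ∀ j, 0 ≤ Y j := fun j => by simp only [hY]; positivity
  -- `ξ j` is the exact change of the exponent when `P` is removed; it vanishes if `P` meets the
  -- neighbourhood proportionally.
  set ξ : Bool × V → ℝ := fun j => l * (Y j - nbrDensity R U j * k) / (u - k) with hξ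
  have hξk : ∀ j, |ξ j| ≤ l * k / D := by
    intro j
    have h1 := nbrDensity_nonneg R U j
    have h2 := nbrDensity_le_one R U j
    have h3 : |Y j - nbrDensity R U j * k| ≤ k := by
      rw [abs_le]
      constructor
      · nlinarith [hY0 j]
      · nlinarith [hYk j]
    simp only [hξ]
    rw [abs_div, abs_mul, abs_of_pos hl, abs_of_pos hD']
    exact div_le_div₀ (by positivity) (mul_le_mul_of_nonneg_left h3 hl.le) hD hUD
  have hlk : l * k / D ≤ 1 := by
    rw [div_le_one hD]
    exact (mul_le_mul_of_nonneg_left hPm hl.le).trans hm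
  have hnew : ∀ j, Real.exp (-l * nbrDensity R (U \ P) j) = a j * Real.exp (ξ j) := by
    intro j
    simp only [ha]
    rw [← Real.exp_add]
    congr 1
    have h1 : ((U \ P).card : ℝ) = u - k := by
      rw [Finset.card_sdiff_of_subset hPU, Nat.cast_sub (Finset.card_le_card hPU)]
    have h2 : (((U \ P).filter fun x => R j.1 j.2 x).card : ℝ) = nbrDensity R U j * u - Y j := by
      have h3 : (U \ P).filter (fun x => R j.1 j.2 x) =
          (U.filter fun x => R j.1 j.2 x) \ (P.filter fun x => R j.1 j.2 x) := by
        ext x; simp only [Finset.mem_filter, Finset.mem_sdiff]; tauto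
      have h4 : (P.filter fun x => R j.1 j.2 x) ⊆ (U.filter fun x => R j.1 j.2 x) :=
        Finset.filter_subset_filter _ hPU
      rw [h3, Finset.card_sdiff_of_subset h4, Nat.cast_sub (Finset.card_le_card h4)]
      unfold nbrDensity
      rw [div_mul_cancel₀ _ hu0.ne']
    have h5 : nbrDensity R (U \ P) j = (nbrDensity R U j * u - Y j) / (u - k) := by
      rw [← h2, ← h1]; rfl
    rw [h5]
    simp only [hξ]
    field_simp
    ring
  -- For `|ξ| ≤ 1` one has `exp ξ ≤ 1 + ξ + ξ ^ 2`. One factor `k` of the square is bounded by `m`,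
  -- so that the errors are linear in the piece size and sum over the pieces.
  have hexp : ∀ j, Real.exp (ξ j) ≤ 1 + ξ j + l ^ 2 * m * k / D ^ 2 := by
    intro j
    have h1 := Real.abs_exp_sub_one_sub_id_le ((hξk j).trans hlk)
    have h2 := (abs_le.1 h1).2
    have h3 : ξ j ^ 2 ≤ (l * k / D) ^ 2 := by
      rw [← sq_abs]
      exact pow_le_pow_left₀ (abs_nonneg _) (hξk j) 2
    have h4 : (l * k / D) ^ 2 ≤ l ^ 2 * m * k / D ^ 2 := by
      rw [div_pow]
      apply div_le_div_of_nonneg_right _ (by positivity)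
      have : 0 ≤ l ^ 2 * k := by positivity
      nlinarith
    linarith
  have hΦ : densityPotential R l U = ∑ j, a j := rfl
  have h1 : densityPotential R l (U \ P) ≤ ∑ j, a j * (1 + ξ j + l ^ 2 * m * k / D ^ 2) := by
    unfold densityPotential
    refine Finset.sum_le_sum fun j _ => ?_
    rw [hnew]
    exact mul_le_mul_of_nonneg_left (hexp j) (ha0 j)
  have h2 : ∑ j, a j * ξ j =
      l / (u - k) * (∑ j, a j * Y j - k * ∑ j, a j * nbrDensity R U j) := by
    rw [Finset.mul_sum, ← Finset.sum_sub_distrib, Finset.mul_sum]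
    refine Finset.sum_congr rfl fun j _ => ?_
    simp only [hξ]
    ring
  have h3 : ∑ j, a j * ξ j ≤ l * g / D * densityPotential R l U := by
    rw [h2]
    have h4 : ∑ j, a j * Y j - k * ∑ j, a j * nbrDensity R U j ≤ g * densityPotential R l U := by
      linarith
    calc _ ≤ l / (u - k) * (g * densityPotential R l U) :=
          mul_le_mul_of_nonneg_left h4 (by positivity)
      _ ≤ l / D * (g * densityPotential R l U) := by
          apply mul_le_mul_of_nonneg_right _ (mul_nonneg hg (densityPotential_nonneg _ _ _))
          exact div_le_div_of_nonneg_left hl.le hD hUD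
      _ = _ := by ring
  calc _ ≤ _ := h1
    _ = ∑ j, a j * ξ j + (∑ j, a j) * (1 + l ^ 2 * m * k / D ^ 2) := by
        rw [Finset.sum_mul, ← Finset.sum_add_distrib]
        exact Finset.sum_congr rfl fun j _ => by ring
    _ ≤ _ := by rw [← hΦ]; linarith

end

open Classical in
/-- Embedding one small tree into the unused set `U` while hardly increasing the potential. -/
theorem exists_tree_embedding_potential_le {V W : Type*} [Fintype V] (R : Bool → V → V → Prop)
    (hR : ∀ b a x, R b a x ↔ R (!b) x a) (U : Finset V) (β ζ η κ ρ l D : ℝ)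
    (hβ : 0 < β) (hζ : 0 < ζ) (hζ1 : ζ ≤ 1 / 2) (hη : 0 ≤ η) (hl : 0 < l) (hD : 0 < D)
    (s m L : ℕ) (hs : 0 < s) (hsβ : (s : ℝ) ≤ β * U.card)
    (hpot : densityPotential R l U < Real.exp (-l * (1 / 2 + β)))
    (hκ1 : 1 / (s : ℝ) ≤ κ) (hκ2 : 1 / (β ^ 2 * ζ * U.card) ≤ κ) (hρ0 : 0 ≤ ρ)
    (hρ : 1 ≤ ρ * (1 - κ * m)) (hρL : ρ ^ L / (1 - ζ) ≤ 1 + η) (hlm : l * m ≤ D)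
    (par : W → W) (e d : W → ℕ) (o : W → Bool) (r : W) (C : Finset W) (hCm : C.card ≤ m)
    (hUD : D ≤ (U.card : ℝ) - C.card)
    (hr : r ∈ C) (hdr : d r = 0)
    (hpar : ∀ i ∈ C, i ≠ r → par i ∈ C ∧ e (par i) < e i ∧ d i = d (par i) + 1)
    (hL : ∀ i ∈ C, d i ≤ L) (q : V) :
    ∃ φ : W → V, (∀ i ∈ C, φ i ∈ U) ∧ Set.InjOn φ C ∧
      (∀ i ∈ C, i ≠ r → R (o i) (φ (par i)) (φ i)) ∧ R (o r) q (φ r) ∧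
      densityPotential R l (U \ C.image φ) ≤ densityPotential R l U *
        Real.exp (2 * l / D + (l * η / D + l ^ 2 * m / D ^ 2) * C.card) := by
  have hU0 : (0 : ℝ) < U.card := by
    have : (0 : ℝ) ≤ C.card := by positivity
    linarith
  have hU : U.Nonempty := Finset.card_pos.1 (by exact_mod_cast hU0)
  have hdeg : ∀ b u, (1 / 2 + β) * U.card ≤ (U.filter fun x => R b u x).card := by
    intro b u
    have := (lt_nbrDensity_of_densityPotential_lt R hl hpot (b, u)).le
    unfold nbrDensity at this
    rwa [le_div_iff₀ hU0] at this
  set a : Bool × V → ℝ := fun j => Real.exp (-l * nbrDensity R U j) with ha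
  have ha0 : ∀ j, 0 ≤ a j := fun j => (Real.exp_pos _).le
  set Φ := densityPotential R l U with hΦ
  have hΦa : Φ = ∑ j, a j := rfl
  have hΦ0 : 0 ≤ Φ := densityPotential_nonneg _ _ _
  -- The cost of `x` is the total weight of the pairs `j` with `x` as neighbour: it is at most `Φ`,
  -- has mean `S` on `U`, and its sum over the image is the linear term of the potential change.
  obtain ⟨φ, hφU, hφi, hφR, hφr, hφc⟩ := exists_tree_embedding_of_dense R hR U hU β ζ κ ρ hβ hζ
    (by linarith) s m L hs hsβ hdeg hκ1 hκ2 hρ0 hρ par e d o r C hCm hr hdr hpar hL q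
    (fun x => ∑ j : Bool × V, if R j.1 j.2 x then a j else 0) Φ
    (fun x => Finset.sum_nonneg fun j _ => by split_ifs; exacts [ha0 j, le_rfl])
    (fun x => Finset.sum_le_sum fun j _ => by split_ifs; exacts [le_rfl, ha0 j])
  clear hR
  refine ⟨φ, hφU, hφi, hφR, hφr, ?_⟩
  have hcard : (C.image φ).card = C.card := Finset.card_image_of_injOn hφi
  set S := ∑ j, a j * nbrDensity R U j with hS
  have hS0 : 0 ≤ S := Finset.sum_nonneg fun j _ => mul_nonneg (ha0 j) (nbrDensity_nonneg _ _ _)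
  have hSΦ : S ≤ Φ := Finset.sum_le_sum fun j _ =>
    mul_le_of_le_one_right (ha0 j) (nbrDensity_le_one _ _ _)
  have hmean : (∑ x ∈ U, ∑ j : Bool × V, if R j.1 j.2 x then a j else 0) / (U.card : ℝ) = S := by
    rw [Finset.sum_comm, Finset.sum_div, hS]
    refine Finset.sum_congr rfl fun j _ => ?_
    rw [← Finset.sum_filter, Finset.sum_const, nsmul_eq_mul]
    unfold nbrDensity
    ring
  have himg : ∑ i ∈ C, ∑ j : Bool × V, (if R j.1 j.2 (φ i) then a j else 0) =
      ∑ j, a j * ((C.image φ).filter fun x => R j.1 j.2 x).card := by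
    rw [Finset.sum_comm]
    refine Finset.sum_congr rfl fun j _ => ?_
    rw [← Finset.sum_image (f := fun x => if R j.1 j.2 x then a j else 0) hφi,
      ← Finset.sum_filter, Finset.sum_const, nsmul_eq_mul]
    ring
  rw [hmean, himg] at hφc
  have h1ζ : 0 < 1 - ζ := by linarith
  have hb : 1 / (1 - ζ) ≤ 2 := by
    rw [div_le_iff₀ h1ζ]; linarith
  have hk0 : (0 : ℝ) ≤ C.card := by positivity
  -- The excess over the mean is `2 * Φ` for the top and at most `η * Φ` for each vertex.
  have h1 : 1 / (1 - ζ) * (Φ + ρ ^ L * (C.card * S)) ≤ C.card * S + (2 + η * C.card) * Φ := by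
    have e1 : 1 / (1 - ζ) * (Φ + ρ ^ L * (C.card * S)) =
        1 / (1 - ζ) * Φ + ρ ^ L / (1 - ζ) * (C.card * S) := by ring
    have e2 := mul_le_mul_of_nonneg_right hb hΦ0
    have e3 := mul_le_mul_of_nonneg_right hρL (mul_nonneg hk0 hS0)
    have e4 : η * (C.card * S) ≤ η * (C.card * Φ) := by gcongr
    rw [e1]
    linarith
  have hkey := densityPotential_sdiff_le R l D (2 + η * C.card) m hl hD (by positivity) U
    (C.image φ) (by
      intro x hx
      obtain ⟨i, hi, rfl⟩ := Finset.mem_image.1 hx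
      exact hφU i hi)
    (by rw [hcard]; exact_mod_cast hCm) hlm (by rw [hcard]; exact hUD)
    (by rw [hcard]; exact hφc.trans h1)
  refine hkey.trans ?_
  apply mul_le_mul_of_nonneg_left _ hΦ0
  rw [hcard]
  have := Real.add_one_le_exp (2 * l / D + (l * η / D + l ^ 2 * m / D ^ 2) * C.card)
  refine le_trans (le_of_eq ?_) this
  ring

/-! ### Rooted trees and their fragmentation. -/

/-- A tree with a root `t` has a parent function and a depth function. -/
theorem SimpleGraph.IsTree.exists_parent {W : Type*} {G : SimpleGraph W} (hG : G.IsTree) (t : W) :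
    ∃ (par : W → W) (d : W → ℕ), d t = 0 ∧
      (∀ w, w ≠ t → G.Adj (par w) w ∧ d w = d (par w) + 1) ∧
      ∀ a b, G.Adj a b → (b ≠ t ∧ par b = a) ∨ (a ≠ t ∧ par a = b) := by
  classical
  have hex : ∀ w, w ≠ t → ∃ z, G.Adj z w ∧ G.dist t w = G.dist t z + 1 := by
    intro w hw
    obtain ⟨p, hp, hpl⟩ := (hG.connected t w).exists_path_of_dist
    have hnil : ¬ p.Nil := fun h => hw h.eq.symm
    refine ⟨p.penultimate, p.adj_penultimate hnil, ?_⟩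
    rcases hG.dist_eq_dist_add_one_of_adj t (p.adj_penultimate hnil) with h | h
    · exfalso
      have h1 : G.dist t p.penultimate ≤ p.dropLast.length := SimpleGraph.dist_le _
      have h2 : p.dropLast.length + 1 = p.length := p.length_dropLast_add_one hnil
      omega
    · exact h
  let par : W → W := fun w => if h : w = t then t else (hex w h).choose
  have hpar : ∀ w, w ≠ t → G.Adj (par w) w ∧ G.dist t w = G.dist t (par w) + 1 := by
    intro w hw
    simp only [par, hw, dite_false]
    exact (hex w hw).choose_spec
  have huniq : ∀ w z z', G.Adj z w → G.Adj z' w → G.dist t w = G.dist t z + 1 →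
      G.dist t w = G.dist t z' + 1 → z = z' := by
    intro w z z' hz hz' hd hd'
    have key : ∀ y, G.Adj y w → G.dist t w = G.dist t y + 1 →
        ∃ p : G.Walk t w, p.IsPath ∧ p.penultimate = y := by
      intro y hy hdy
      obtain ⟨p, hp, hpl⟩ := (hG.connected t y).exists_path_of_dist
      have hw : w ∉ p.support := by
        intro hw
        have h1 := SimpleGraph.dist_le (p.takeUntil w hw)
        have h2 := p.length_takeUntil_le_length hw
        omega
      exact ⟨p.concat hy, hp.concat hw hy, by simp⟩
    obtain ⟨p, hp, rfl⟩ := key z hz hd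
    obtain ⟨q, hq, rfl⟩ := key z' hz' hd'
    rw [(hG.existsUnique_path t w).unique hp hq]
  refine ⟨par, G.dist t, SimpleGraph.dist_self, hpar, ?_⟩
  intro a b hab
  rcases hG.dist_eq_dist_add_one_of_adj t hab with h | h
  · right
    have hat : a ≠ t := by
      rintro rfl
      rw [SimpleGraph.dist_self] at h
      omega
    exact ⟨hat, huniq a _ _ (hpar a hat).1 hab.symm (hpar a hat).2 h⟩
  · left
    have hbt : b ≠ t := by
      rintro rfl
      rw [SimpleGraph.dist_self] at h
      omega
    exact ⟨hbt, huniq b _ _ (hpar b hbt).1 hab (hpar b hbt).2 h⟩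

section
variable {W : Type*} (par : W → W) (d : W → ℕ) (t : W)

/-- Recursion from the root of a tree: every vertex inherits the value of its parent, except where
a new value is started. -/
theorem exists_top_of_cut (hpar : ∀ w, w ≠ t → d w = d (par w) + 1) (R : W → Prop) :
    ∃ fr : W → W, (∀ w, w = t ∨ R (par w) → fr w = w) ∧
      ∀ w, ¬ (w = t ∨ R (par w)) → fr w = fr (par w) := by
  classical
  let fr : W → W := (measure d).wf.fix fun w ih =>
    if h : w = t ∨ R (par w) then w else
      ih (par w) (by
        have := hpar w (fun h' => h (Or.inl h'))
        change d (par w) < d w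
        omega)
  have hfr : ∀ w, fr w = if w = t ∨ R (par w) then w else fr (par w) := by
    intro w
    have := (measure d).wf.fix_eq (fun w ih =>
      if h : w = t ∨ R (par w) then w else
        ih (par w) (by
          have := hpar w (fun h' => h (Or.inl h'))
          change d (par w) < d w
          omega)) w
    simpa [fr] using this
  exact ⟨fr, fun w h => by rw [hfr, if_pos h], fun w h => by rw [hfr, if_neg h]⟩

open Classical in
/-- Recursion from the leaves of a tree, with truncated sizes: the size of the part below a vertex
counts as one as soon as it exceeds `m`, or at prescribed vertices. -/
theorem exists_truncated_size [Fintype W] (hpar : ∀ w, w ≠ t → d w = d (par w) + 1) (m : ℕ)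
    (R : W → Prop) :
    ∃ c : W → ℕ, ∀ y, c y = 1 + ∑ z ∈ Finset.univ.filter (fun z => z ≠ t ∧ par z = y),
      if R z ∨ m < c z then 1 else c z := by
  let B : ℕ := Finset.univ.sup d
  have hB : ∀ w, d w ≤ B := fun w => Finset.le_sup (Finset.mem_univ w)
  have hdec : ∀ y z, z ∈ Finset.univ.filter (fun z => z ≠ t ∧ par z = y) → B - d z < B - d y := by
    intro y z hz
    obtain ⟨h1, h2⟩ := (Finset.mem_filter.1 hz).2
    have h3 := hpar z h1
    rw [h2] at h3
    have := hB z
    omega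
  let c : W → ℕ := (measure fun w => B - d w).wf.fix fun y ih =>
    1 + ∑ z ∈ (Finset.univ.filter (fun z => z ≠ t ∧ par z = y)).attach,
      if R z ∨ m < ih z (hdec y z z.2) then 1 else ih z (hdec y z z.2)
  refine ⟨c, fun y => ?_⟩
  have := (measure fun w => B - d w).wf.fix_eq (fun y ih =>
    1 + ∑ z ∈ (Finset.univ.filter (fun z => z ≠ t ∧ par z = y)).attach,
      if R z ∨ m < ih z (hdec y z z.2) then 1 else ih z (hdec y z z.2)) y
  rw [← Finset.sum_attach]
  exact this

open Classical in
theorem sum_children [Fintype W] (A : Finset W) (f : W → ℕ) :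
    ∑ w ∈ A, ∑ z ∈ Finset.univ.filter (fun z => z ≠ t ∧ par z = w), f z =
      ∑ z ∈ Finset.univ.filter (fun z => z ≠ t ∧ par z ∈ A), f z := by
  rw [← Finset.sum_fiberwise_of_maps_to (t := A) (g := par)
    (s := Finset.univ.filter (fun z => z ≠ t ∧ par z ∈ A)) (f := f)
    (fun z hz => (Finset.mem_filter.1 hz).2.2)]
  refine Finset.sum_congr rfl fun w hw => Finset.sum_congr ?_ fun _ _ => rfl
  ext z
  simp only [Finset.mem_filter, Finset.mem_univ, true_and]
  constructor
  · rintro ⟨h1, rfl⟩; exact ⟨⟨h1, hw⟩, rfl⟩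
  · rintro ⟨⟨h1, -⟩, h2⟩; exact ⟨h1, h2⟩

open Classical in
/-- A rooted tree can be cut below few vertices and few levels into pieces which are small and have
bounded height; `fr w` is the top vertex of the piece containing `w`. -/
theorem exists_fragmentation [Fintype W] (hpar : ∀ w, w ≠ t → d w = d (par w) + 1)
    (m L Δ : ℕ) (hm : 0 < m) (hL : 0 < L)
    (hΔ : ∀ s, (Finset.univ.filter fun z => z ≠ t ∧ par z = s).card ≤ Δ) :
    ∃ fr : W → W, (∀ w, w ≠ t → fr w ≠ t ∧ fr (fr w) = fr w ∧ d (fr w) ≤ d w ∧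
        d w < d (fr w) + L ∧ (fr w ≠ w → par w ≠ t ∧ fr w = fr (par w))) ∧
      (∀ y, (Finset.univ.filter fun w => w ≠ t ∧ fr w = y).card ≤ m) ∧
      (Finset.univ.filter fun w => w ≠ t ∧ fr w = w).card ≤
        (Fintype.card W / m + 1) * Δ + (Fintype.card W / L + 1) := by
  -- Pigeonhole picks a residue class of levels with few vertices; making these vertices tops bounds
  -- the heights by `L`.
  obtain ⟨j, hjmem, hj⟩ := Finset.exists_card_fiber_le_of_card_le_mul
    (s := (Finset.univ : Finset W)) (t := Finset.range L) (f := fun w => d w % L)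
    (n := Fintype.card W / L + 1) ⟨0, Finset.mem_range.2 hL⟩ (by
      rw [Finset.card_range, Finset.card_univ]
      exact (Nat.lt_mul_div_succ _ hL).le)
  obtain ⟨c, hc⟩ := exists_truncated_size par d t hpar m (fun w => (d w + 1) % L = j)
  -- `c' z` is what `z` passes to its parent: only itself once a cut is made below `z`.
  obtain ⟨c', hc'⟩ : ∃ c' : W → ℕ, ∀ z, c' z = if (d z + 1) % L = j ∨ m < c z then 1 else c z :=
    ⟨_, fun _ => rfl⟩
  replace hc : ∀ y, c y = 1 + ∑ z ∈ Finset.univ.filter (fun z => z ≠ t ∧ par z = y), c' z := by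
    intro y
    rw [hc]
    congr 1
    refine Finset.sum_congr rfl fun z _ => ?_
    rw [hc']
    congr
  have hc1 : ∀ y, 1 ≤ c y := fun y => by rw [hc]; omega
  have hc'c : ∀ y, c' y ≤ c y := fun y => by
    have := hc1 y
    rw [hc']; split_ifs <;> omega
  have hc'm : ∀ y, c' y ≤ m := fun y => by
    rw [hc']; split_ifs <;> omega
  set R : W → Prop := fun w => w = t ∨ (d w + 1) % L = j ∨ m < c w with hR
  obtain ⟨fr, hfr, hfr'⟩ := exists_top_of_cut par d t hpar R
  have hind : ∀ w, w ≠ t → fr w ≠ t ∧ fr (fr w) = fr w ∧ d (fr w) ≤ d w ∧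
      ∀ k, d (fr w) ≤ k → k < d w → (k + 1) % L ≠ j := by
    intro w
    induction h : d w using Nat.strong_induction_on generalizing w with
    | _ n ih =>
      intro hw
      by_cases hRw : R (par w)
      · rw [hfr w (Or.inr hRw)]
        exact ⟨hw, hfr w (Or.inr hRw), h.le, fun k h1 h2 => by omega⟩
      · have hpt : par w ≠ t := fun h' => hRw (Or.inl h')
        have hdw := hpar w hw
        rw [hfr' w (by tauto)]
        obtain ⟨h1, h2, h3, h4⟩ := ih (d (par w)) (by omega) (par w) rfl hpt
        refine ⟨h1, h2, by omega, fun k h5 h6 => ?_⟩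
        rcases Nat.lt_or_ge k (d (par w)) with h7 | h7
        · exact h4 k h5 h7
        · have : k = d (par w) := by omega
          subst this
          exact fun h' => hRw (Or.inr (Or.inl h'))
  have hne : ∀ w, w ≠ t → fr w ≠ w → par w ≠ t ∧ fr w = fr (par w) ∧ ¬ R (par w) := by
    intro w hw hne
    have hRw : ¬ R (par w) := fun h => hne (hfr w (Or.inr h))
    exact ⟨fun h' => hRw (Or.inl h'), hfr' w (by tauto), hRw⟩
  refine ⟨fr, fun w hw => ?_, fun y => ?_, ?_⟩
  · obtain ⟨h1, h2, h3, h4⟩ := hind w hw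
    refine ⟨h1, h2, h3, ?_, fun h => ⟨(hne w hw h).1, (hne w hw h).2.1⟩⟩
    by_contra hlt
    have hjL : j < L := Finset.mem_range.1 hjmem
    set a := d (fr w) + 1 with ha
    -- the representative of `j` in the `L` consecutive numbers starting at `a`
    obtain ⟨k, hk1, hk2, hk3⟩ : ∃ k, a ≤ k ∧ k < a + L ∧ k % L = j := by
      refine ⟨a + (j + (L - a % L)) % L, by omega, ?_, ?_⟩
      · have := Nat.mod_lt (j + (L - a % L)) hL
        omega
      · rw [Nat.add_mod, Nat.mod_mod, ← Nat.add_mod]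
        have h5 := Nat.div_add_mod a L
        have h6 := Nat.mod_lt a hL
        have h7 : a + (j + (L - a % L)) = j + L * (a / L + 1) := by
          rw [mul_add]; omega
        rw [h7, Nat.add_mul_mod_self_left, Nat.mod_eq_of_lt hjL]
    have := h4 (k - 1) (by omega) (by omega)
    rw [Nat.sub_add_cancel (by omega)] at this
    exact this hk3
  · set Fr := Finset.univ.filter fun w => w ≠ t ∧ fr w = y with hFr
    by_cases hy : y ≠ t ∧ fr y = y
    · have hyF : y ∈ Fr := by simp [hFr, hy]
      -- Summing the recursion over a piece telescopes to `Fr.card ≤ c' y`, because every vertex of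
      -- the piece except its top `y` is a child of an uncut vertex of the piece.
      set A := Fr.filter fun w => ¬ R w with hA
      have h1 : ∀ w ∈ Fr, c' w = 1 + if w ∈ A then
          ∑ z ∈ Finset.univ.filter (fun z => z ≠ t ∧ par z = w), c' z else 0 := by
        intro w hw
        have hwt : w ≠ t := (Finset.mem_filter.1 hw).2.1
        by_cases hRw : R w
        · have : w ∉ A := fun h => (Finset.mem_filter.1 h).2 hRw
          rw [if_neg this, hc', if_pos (hRw.resolve_left hwt)]
        · have : w ∈ A := Finset.mem_filter.2 ⟨hw, hRw⟩
          rw [if_pos this, hc', if_neg (fun h => hRw (Or.inr h)), ← hc]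
      have h2 : ∑ w ∈ Fr, c' w = Fr.card +
          ∑ z ∈ Finset.univ.filter (fun z => z ≠ t ∧ par z ∈ A), c' z := by
        rw [Finset.sum_congr rfl h1, Finset.sum_add_distrib, ← sum_children,
          ← Finset.sum_filter, Finset.filter_mem_eq_inter,
          Finset.inter_eq_right.2 (Finset.filter_subset _ _), Finset.card_eq_sum_ones]
      have h3 : ∑ z ∈ Fr.erase y, c' z ≤
          ∑ z ∈ Finset.univ.filter (fun z => z ≠ t ∧ par z ∈ A), c' z := by
        apply Finset.sum_le_sum_of_subset
        intro z hz
        obtain ⟨hzy, hzF⟩ := Finset.mem_erase.1 hz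
        obtain ⟨hzt, hzfr⟩ := (Finset.mem_filter.1 hzF).2
        obtain ⟨h4, h5, h6⟩ := hne z hzt (fun h => hzy (by rw [← h, hzfr]))
        refine Finset.mem_filter.2 ⟨Finset.mem_univ _, hzt, Finset.mem_filter.2 ⟨?_, h6⟩⟩
        exact Finset.mem_filter.2 ⟨Finset.mem_univ _, h4, by rw [← h5, hzfr]⟩
      have h4 := Finset.add_sum_erase Fr c' hyF
      have h5 := hc'm y
      omega
    · have : Fr = ∅ := by
        rw [Finset.eq_empty_iff_forall_notMem]
        intro w hw
        obtain ⟨hwt, hwy⟩ := (Finset.mem_filter.1 hw).2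
        obtain ⟨h1, h2, -⟩ := hind w hwt
        rw [hwy] at h1 h2
        exact hy ⟨h1, h2⟩
      rw [this]; simp
  · set S := Finset.univ.filter fun w => m < c w with hS
    have hScard : S.card ≤ Fintype.card W / m := by
      rw [Nat.le_div_iff_mul_le hm]
      -- Truncation loses at least `m` at each vertex of `S`, while `∑ c` exceeds `∑ c'` by at most
      -- the number of vertices.
      have h1 : ∑ y, c y = Fintype.card W +
          ∑ z ∈ Finset.univ.filter (fun z => z ≠ t ∧ par z ∈ (Finset.univ : Finset W)), c' z := by
        rw [← sum_children, Finset.sum_congr rfl fun y _ => hc y, Finset.sum_add_distrib]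
        simp
      have h2 : ∑ z ∈ Finset.univ.filter (fun z => z ≠ t ∧ par z ∈ (Finset.univ : Finset W)), c' z ≤
          ∑ z, c' z := Finset.sum_le_sum_of_subset (Finset.subset_univ _)
      have h3 : S.card * m + ∑ z, c' z ≤ ∑ z, c z := by
        have h4 : S.card * m = ∑ z, if m < c z then m else 0 := by
          rw [← Finset.sum_filter, Finset.sum_const, smul_eq_mul]
        rw [h4, ← Finset.sum_add_distrib]
        refine Finset.sum_le_sum fun z _ => ?_
        have := hc'c z
        split_ifs with h
        · have : c' z = 1 := by rw [hc', if_pos (Or.inr h)]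
          omega
        · omega
      omega
    have hsub : (Finset.univ.filter fun w => w ≠ t ∧ fr w = w) ⊆
        ((insert t S).biUnion fun s => Finset.univ.filter fun z => z ≠ t ∧ par z = s) ∪
          (Finset.univ.filter fun w => d w % L = j) := by
      intro w hw
      obtain ⟨hwt, hww⟩ := (Finset.mem_filter.1 hw).2
      have hdw := hpar w hwt
      have hRw : R (par w) := by
        by_contra hRw
        have h1 := hfr' w (by tauto)
        have h2 := (hind (par w) (fun h' => hRw (Or.inl h'))).2.2.1
        rw [← h1, hww] at h2
        omega
      simp only [Finset.mem_union, Finset.mem_biUnion, Finset.mem_filter, Finset.mem_univ,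
        true_and, Finset.mem_insert, hS]
      rcases hRw with h | h | h
      · exact Or.inl ⟨t, Or.inl rfl, hwt, h⟩
      · right; rw [hdw]; exact h
      · exact Or.inl ⟨par w, Or.inr h, hwt, rfl⟩
    refine (Finset.card_le_card hsub).trans ((Finset.card_union_le _ _).trans ?_)
    apply add_le_add _ hj
    refine (Finset.card_biUnion_le_card_mul _ _ Δ fun s _ => hΔ s).trans ?_
    apply Nat.mul_le_mul_right
    exact (Finset.card_insert_le _ _).trans (by omega)

end

/-! ### Embedding the pieces one after another. -/

open Classical in
/-- If a rooted tree is cut into few small pieces of bounded height, then it can be embedded piece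
by piece as long as the potential stays below its critical value. -/
theorem exists_embedding_of_fragmentation {V W : Type*} [Fintype V] [Fintype W]
    (R : Bool → V → V → Prop) (hR : ∀ b a x, R b a x ↔ R (!b) x a)
    (v : V) (par : W → W) (d : W → ℕ) (t : W) (o : W → Bool) (fr : W → W)
    (β ζ η κ ρ l D : ℝ) (hβ : 0 < β) (hζ : 0 < ζ) (hζ1 : ζ ≤ 1 / 2) (hη : 0 ≤ η) (hl : 0 < l)
    (hD : 0 < D) (s m L : ℕ) (hs : 0 < s) (hsβ : (s : ℝ) ≤ β * D)
    (hκ1 : 1 / (s : ℝ) ≤ κ) (hκ2 : 1 / (β ^ 2 * ζ * D) ≤ κ) (hρ0 : 0 ≤ ρ)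
    (hρ : 1 ≤ ρ * (1 - κ * m)) (hρL : ρ ^ L / (1 - ζ) ≤ 1 + η) (hlm : l * m ≤ D)
    (hVW : D ≤ (Fintype.card V : ℝ) - Fintype.card W)
    (hpar : ∀ w, w ≠ t → d w = d (par w) + 1)
    (hfr : ∀ w, w ≠ t → fr w ≠ t ∧ fr (fr w) = fr w ∧ d (fr w) ≤ d w ∧
        d w < d (fr w) + L ∧ (fr w ≠ w → par w ≠ t ∧ fr w = fr (par w)))
    (hm : ∀ y, (Finset.univ.filter fun w => w ≠ t ∧ fr w = y).card ≤ m)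
    (hpot : densityPotential R l (Finset.univ \ {v}) * Real.exp (2 * l / D *
        (Finset.univ.filter fun w => w ≠ t ∧ fr w = w).card +
        (l * η / D + l ^ 2 * m / D ^ 2) * Fintype.card W) < Real.exp (-l * (1 / 2 + β))) :
    ∃ φ : W → V, Function.Injective φ ∧ φ t = v ∧ ∀ w, w ≠ t → R (o w) (φ (par w)) (φ w) := by
  set Φ₀ := densityPotential R l (Finset.univ \ {v}) with hΦ₀
  have hΦ₀0 : 0 ≤ Φ₀ := densityPotential_nonneg _ _ _
  set B := l * η / D + l ^ 2 * m / D ^ 2 with hB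
  have hB0 : 0 ≤ B := by positivity
  set roots := Finset.univ.filter fun w => w ≠ t ∧ fr w = w with hroots
  obtain ⟨P, hP⟩ : ∃ P : Finset W → Finset W, ∀ X w, w ∈ P X ↔ (w = t ∨ fr w ∈ X ∧ w ≠ t) :=
    ⟨fun X => Finset.univ.filter fun w => w = t ∨ fr w ∈ X ∧ w ≠ t, fun X w => by simp⟩
  -- Tops enter in order of depth, and `X` is closed under passing to the piece of a top's parent,
  -- so that parent is always embedded first.
  have main : ∀ X : Finset W, X ⊆ roots → (∀ y ∈ X, par y ≠ t → fr (par y) ∈ X) →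
      ∃ φ : W → V, Set.InjOn φ (P X) ∧ φ t = v ∧
        (∀ w ∈ P X, w ≠ t → R (o w) (φ (par w)) (φ w)) ∧
        densityPotential R l (Finset.univ \ (P X).image φ) ≤
          Φ₀ * Real.exp (2 * l / D * X.card + B * (P X).card) := by
    intro X
    induction X using Finset.induction_on_max_value d with
    | empty =>
      intro _ _
      have hP0 : P ∅ = {t} := by ext w; simp [hP]
      refine ⟨fun _ => v, ?_, rfl, ?_, ?_⟩
      · rw [hP0]; simp
      · intro w hw hwt
        rw [hP0] at hw
        exact absurd (Finset.mem_singleton.1 hw) hwt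
      · rw [hP0, Finset.image_singleton]
        apply le_mul_of_one_le_right hΦ₀0
        apply Real.one_le_exp
        positivity
    | insert a X haX hmax ih =>
      intro hsub hcl
      have hasub := hsub (Finset.mem_insert_self a X)
      obtain ⟨hat, haa⟩ := (Finset.mem_filter.1 hasub).2
      have hXsub : X ⊆ roots := fun y hy => hsub (Finset.mem_insert_of_mem hy)
      have hpar_a : ∀ y ∈ roots, d y ≤ d a → par y ≠ t → fr (par y) ≠ a := by
        intro y hy hya hyt h
        have hyt' := (Finset.mem_filter.1 hy).2.1
        have h1 := hpar y hyt'
        have h2 := (hfr (par y) hyt).2.2.1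
        rw [h] at h2
        omega
      obtain ⟨φ, hφi, hφt, hφR, hφp⟩ := ih hXsub (fun y hy hyt =>
        (Finset.mem_insert.1 (hcl y (Finset.mem_insert_of_mem hy) hyt)).resolve_left
          (hpar_a y (hXsub hy) (hmax y hy) hyt))
      set C := Finset.univ.filter fun w => w ≠ t ∧ fr w = a with hC
      have hCmem : ∀ w, w ∈ C ↔ (w ≠ t ∧ fr w = a) := fun w => by simp [hC]
      have hdisj : Disjoint (P X) C := by
        rw [Finset.disjoint_left]
        intro w hw hwC
        rw [hCmem] at hwC
        rw [hP] at hw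
        rcases hw with h | h
        · exact hwC.1 h
        · rw [hwC.2] at h; exact haX h.1
      have hPins : P (insert a X) = P X ∪ C := by
        ext w
        rw [Finset.mem_union, hP, hP, hCmem, Finset.mem_insert]
        tauto
      have hPC : (P X).card + C.card ≤ Fintype.card W := by
        rw [← Finset.card_union_of_disjoint hdisj]
        exact Finset.card_le_univ _
      have hPC' : ((P X).card : ℝ) + C.card ≤ Fintype.card W := by exact_mod_cast hPC
      have hXr : X.card ≤ roots.card := Finset.card_le_card hXsub
      set U := Finset.univ \ (P X).image φ with hU
      have hUcard : (U.card : ℝ) = Fintype.card V - (P X).card := by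
        rw [hU, ← Finset.card_image_of_injOn hφi, ← Finset.compl_eq_univ_sdiff, Finset.card_compl,
          Nat.cast_sub (Finset.card_le_univ _)]
      have hC0 : (0 : ℝ) ≤ C.card := Nat.cast_nonneg _
      have hUD : D ≤ (U.card : ℝ) - C.card := by rw [hUcard]; linarith
      have hUD' : D ≤ (U.card : ℝ) := by linarith
      -- The exponent accumulated so far is at most that of the whole embedding, which `hpot` keeps
      -- below the threshold.
      have hpotU : densityPotential R l U < Real.exp (-l * (1 / 2 + β)) := by
        refine lt_of_le_of_lt (hφp.trans ?_) hpot
        apply mul_le_mul_of_nonneg_left _ hΦ₀0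
        apply Real.exp_le_exp.2
        have h1 : (X.card : ℝ) ≤ roots.card := by exact_mod_cast hXr
        have h2 : ((P X).card : ℝ) ≤ Fintype.card W := by linarith
        have h3 : 0 ≤ 2 * l / D := by positivity
        gcongr
      have haC : a ∈ C := (hCmem a).2 ⟨hat, haa⟩
      obtain ⟨ψ, hψU, hψi, hψR, hψr, hψp⟩ := exists_tree_embedding_potential_le R hR U β ζ η κ ρ l D
        hβ hζ hζ1 hη hl hD s m L hs (hsβ.trans (mul_le_mul_of_nonneg_left hUD' hβ.le)) hpotU hκ1
        (le_trans (one_div_le_one_div_of_le (by positivity)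
          (mul_le_mul_of_nonneg_left hUD' (by positivity))) hκ2)
        hρ0 hρ hρL hlm par d (fun w => d w - d a) o a C (hm a) hUD haC (by simp)
        (fun i hi hia => by
          obtain ⟨h1, h2⟩ := (hCmem i).1 hi
          obtain ⟨h3, h4⟩ := (hfr i h1).2.2.2.2 (by rw [h2]; exact hia.symm)
          have h5 := hpar i h1
          have h6 := (hfr (par i) h3).2.2.1
          rw [← h4, h2] at h6
          exact ⟨(hCmem _).2 ⟨h3, by rw [← h4, h2]⟩, by omega, by omega⟩)
        (fun i hi => by
          obtain ⟨h1, h2⟩ := (hCmem i).1 hi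
          have := (hfr i h1).2.2.2.1
          rw [h2] at this
          omega) (φ (par a))
      have hψφ : ∀ i ∈ C, ∀ k ∈ P X, ψ i ≠ φ k := by
        intro i hi k hk h
        have := hψU i hi
        rw [hU, Finset.mem_sdiff] at this
        exact this.2 (Finset.mem_image.2 ⟨k, hk, h.symm⟩)
      obtain ⟨θ, hθ⟩ : ∃ θ : W → V, ∀ w, θ w = if w ∈ C then ψ w else φ w := ⟨_, fun _ => rfl⟩
      have hθC : ∀ w ∈ C, θ w = ψ w := fun w hw => by rw [hθ, if_pos hw]
      have hθP : ∀ w ∈ P X, θ w = φ w := fun w hw => by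
        rw [hθ, if_neg (Finset.disjoint_left.1 hdisj hw)]
      have htP : t ∈ P X := (hP X t).2 (Or.inl rfl)
      refine ⟨θ, ?_, by rw [hθP t htP, hφt], ?_, ?_⟩
      · rw [hPins]
        intro i hi k hk hik
        rw [Finset.mem_coe, Finset.mem_union] at hi hk
        rcases hi with hi | hi <;> rcases hk with hk | hk
        · rw [hθP i hi, hθP k hk] at hik; exact hφi hi hk hik
        · rw [hθP i hi, hθC k hk] at hik; exact absurd hik.symm (hψφ k hk i hi)
        · rw [hθC i hi, hθP k hk] at hik; exact absurd hik (hψφ i hi k hk)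
        · rw [hθC i hi, hθC k hk] at hik; exact hψi hi hk hik
      · intro w hw hwt
        rw [hPins, Finset.mem_union] at hw
        rcases hw with hw | hw
        · have hwp : par w ∈ P X := by
            rw [hP]
            by_cases hpt : par w = t
            · exact Or.inl hpt
            · right
              refine ⟨?_, hpt⟩
              have hfw := (((hP X w).1 hw).resolve_left hwt).1
              by_cases hfww : fr w = w
              · rw [hfww] at hfw
                refine (Finset.mem_insert.1 (hcl w (Finset.mem_insert_of_mem hfw) hpt)).resolve_left
                  (hpar_a w (hXsub hfw) (hmax w hfw) hpt)
              · rw [← ((hfr w hwt).2.2.2.2 hfww).2]; exact hfw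
          rw [hθP w hw, hθP _ hwp]
          exact hφR w hw hwt
        · by_cases hwa : w = a
          · subst hwa
            have hwp : par w ∈ P X := by
              rw [hP]
              by_cases hpt : par w = t
              · exact Or.inl hpt
              · exact Or.inr ⟨(Finset.mem_insert.1 (hcl w (Finset.mem_insert_self _ _)
                  hpt)).resolve_left (hpar_a w hasub le_rfl hpt), hpt⟩
            rw [hθC w hw, hθP _ hwp]
            exact hψr
          · obtain ⟨h1, h2⟩ := (hCmem w).1 hw
            obtain ⟨h3, h4⟩ := (hfr w h1).2.2.2.2 (by rw [h2]; exact fun h => hwa h.symm)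
            have hwp : par w ∈ C := (hCmem _).2 ⟨h3, by rw [← h4, h2]⟩
            rw [hθC w hw, hθC _ hwp]
            exact hψR w hw hwa
      · have himg : Finset.univ \ (P (insert a X)).image θ = U \ C.image ψ := by
          rw [hPins, Finset.image_union, Finset.image_congr (g := φ) (fun w hw => hθP w hw),
            Finset.image_congr (s := C) (g := ψ) (fun w hw => hθC w hw), hU, sdiff_sdiff_left]
          rfl
        rw [himg, hPins, Finset.card_union_of_disjoint hdisj, Finset.card_insert_of_notMem haX]
        refine hψp.trans ((mul_le_mul_of_nonneg_right hφp (Real.exp_pos _).le).trans (le_of_eq ?_))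
        rw [mul_assoc, ← Real.exp_add]
        congr 2
        push_cast
        ring
  obtain ⟨φ, hφi, hφt, hφR, -⟩ := main roots subset_rfl (fun y hy hyt => by
    obtain ⟨h1, h2, -⟩ := hfr (par y) hyt
    exact Finset.mem_filter.2 ⟨Finset.mem_univ _, h1, h2⟩)
  have hall : ∀ w, w ∈ P roots := by
    intro w
    rw [hP]
    by_cases hw : w = t
    · exact Or.inl hw
    · obtain ⟨h1, h2, -⟩ := hfr w hw
      exact Or.inr ⟨Finset.mem_filter.2 ⟨Finset.mem_univ _, h1, h2⟩, hw⟩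
  exact ⟨φ, fun a b hab => hφi (hall a) (hall b) hab, hφt, fun w hw => hφR w (hall w) hw⟩

/-! ### Choice of parameters. -/

/-- One factor `1 - η / 4` is the top's loss `1 - ζ`, the other is Bernoulli's lower bound for `(1 -
κ * m) ^ L`. -/
theorem one_le_one_add_mul_sq {η : ℝ} (h0 : 0 ≤ η) (h1 : η ≤ 1) :
    1 ≤ (1 + η) * ((1 - η / 4) * (1 - η / 4)) := by
  have h2 := mul_nonneg h0 (sub_nonneg.2 h1)
  have h3 : 0 ≤ η ^ 3 := by positivity
  have h4 : (1 + η) * ((1 - η / 4) * (1 - η / 4)) =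
      1 + 7 / 16 * (η * (1 - η)) + η / 16 + η ^ 3 / 16 := by ring
  linarith

set_option maxHeartbeats 1000000 in
/-- For a maximum degree below `c * n / log n` with `c` small, all the parameters of the embedding
can be chosen consistently. -/
theorem exists_embedding_parameters (ε α c : ℝ) (hε : 0 < ε) (hε1 : ε ≤ 1) (hα : 0 < α)
    (hα1 : α ≤ 1) (hc : 0 < c) (hcf : c ≤ (ε * α) ^ 3 / 10 ^ 6) (n : ℕ) (hn : 0 < n)
    (hlog : 1 / c ≤ Real.log n) :
    ∃ (s m L : ℕ) (ζ η κ ρ l : ℝ), 2 ≤ α * n ∧ 0 < ζ ∧ ζ ≤ 1 / 2 ∧ 0 ≤ η ∧ 0 < l ∧ 0 < s ∧ 0 < m ∧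
      0 < L ∧ (s : ℝ) ≤ α / 2 * (ε * n) ∧ 1 / (s : ℝ) ≤ κ ∧
      1 / ((α / 2) ^ 2 * ζ * (ε * n)) ≤ κ ∧ 0 ≤ ρ ∧ 1 ≤ ρ * (1 - κ * m) ∧
      ρ ^ L / (1 - ζ) ≤ 1 + η ∧ l * m ≤ ε * n ∧
      ∀ N Δ k : ℕ, N ≤ n → (Δ : ℝ) ≤ 2 * (c * n / Real.log n) →
        k ≤ (N / m + 1) * Δ + (N / L + 1) →
        2 * n * Real.exp (-l * (1 / 2 + 3 * α / 4)) * Real.exp (2 * l / (ε * n) * k +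
          (l * η / (ε * n) + l ^ 2 * m / (ε * n) ^ 2) * N) <
        Real.exp (-l * (1 / 2 + α / 2)) := by
  have hn0 : (0 : ℝ) < n := by exact_mod_cast hn
  obtain ⟨θ, hθ⟩ : ∃ θ, θ = ε * α := ⟨_, rfl⟩
  rw [← hθ] at hcf
  have hθ0 : 0 < θ := by rw [hθ]; positivity
  have hθα : θ ≤ α := by rw [hθ]; exact mul_le_of_le_one_left hα.le hε1
  have hθ1 : θ ≤ 1 := hθα.trans hα1
  obtain ⟨x, hx⟩ : ∃ x, x = Real.log n := ⟨_, rfl⟩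
  rw [← hx] at hlog
  have hθ3 : 0 < θ ^ 3 := by positivity
  have hx1 : 10 ^ 6 ≤ x * θ ^ 3 := by
    have h1 : 1 ≤ x * c := by rwa [div_le_iff₀ hc] at hlog
    have hx0 : 0 < x := lt_of_lt_of_le (by positivity) hlog
    have h2 : x * c ≤ x * (θ ^ 3 / 10 ^ 6) := mul_le_mul_of_nonneg_left hcf hx0.le
    have h3 : x * (θ ^ 3 / 10 ^ 6) = x * θ ^ 3 / 10 ^ 6 := by ring
    rw [h3] at h2
    have h4 := h1.trans h2
    rwa [le_div_iff₀ (by positivity), one_mul] at h4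
  have hx0 : 0 < x := lt_of_lt_of_le (by positivity) hlog
  have hxθ2 : 10 ^ 6 ≤ x * θ ^ 2 := by
    refine hx1.trans (mul_le_mul_of_nonneg_left ?_ hx0.le)
    exact pow_le_pow_of_le_one hθ0.le hθ1 (by norm_num)
  have hxθ1 : 10 ^ 6 ≤ x * θ := by
    refine hxθ2.trans (mul_le_mul_of_nonneg_left ?_ hx0.le)
    exact pow_le_of_le_one hθ0.le hθ1 (by norm_num)
  have hx6 : 10 ^ 6 ≤ x := hxθ1.trans (mul_le_of_le_one_right hx0.le hθ1)
  have hnx : x ^ 2 / 2 ≤ n := by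
    have h1 := Real.quadratic_le_exp_of_nonneg hx0.le
    rw [hx, Real.exp_log hn0, ← hx] at h1
    linarith
  have hnx' : x ≤ n := by nlinarith
  have hnθ : 10 ^ 6 ≤ n * θ := hxθ1.trans (mul_le_mul_of_nonneg_right hnx' hθ0.le)
  -- the bound on the size of the pieces
  obtain ⟨M, hM⟩ : ∃ M, M = θ ^ 2 * n / (512 * x) := ⟨_, rfl⟩
  have hM1 : 1 ≤ M := by
    rw [hM, le_div_iff₀ (by positivity)]
    have : 512 * x ≤ θ ^ 2 * (x ^ 2 / 2) := by nlinarith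
    have h2 : θ ^ 2 * (x ^ 2 / 2) ≤ θ ^ 2 * n := mul_le_mul_of_nonneg_left hnx (by positivity)
    linarith
  have hmM : (⌊M⌋₊ : ℝ) ≤ M := Nat.floor_le (by linarith)
  have hm0 : 0 < ⌊M⌋₊ := Nat.floor_pos.2 hM1
  have hmM2 : M / 2 ≤ ⌊M⌋₊ := by
    have h1 := Nat.lt_floor_add_one M
    have h2 : (1 : ℝ) ≤ ⌊M⌋₊ := by exact_mod_cast hm0
    linarith
  have hs1 : 1 ≤ α / 2 * (ε * n) := by
    have : α / 2 * (ε * n) = n * θ / 2 := by rw [hθ]; ring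
    rw [this]; linarith
  obtain ⟨S, hS⟩ : ∃ S, S = α / 2 * (ε * n) := ⟨_, rfl⟩
  have hSθ : S = n * θ / 2 := by rw [hS, hθ]; ring
  rw [← hS] at hs1
  have hs0 : 0 < ⌊S⌋₊ := Nat.floor_pos.2 hs1
  have hsS : (⌊S⌋₊ : ℝ) ≤ S := Nat.floor_le (by linarith)
  have hsS2 : S / 2 ≤ ⌊S⌋₊ := by
    have h1 := Nat.lt_floor_add_one S
    have h2 : (1 : ℝ) ≤ ⌊S⌋₊ := by exact_mod_cast hs0
    linarith
  obtain ⟨L, hL⟩ : ∃ L : ℕ, L = ⌈256 / θ⌉₊ := ⟨_, rfl⟩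
  have hL1 : 256 / θ ≤ L := by rw [hL]; exact Nat.le_ceil _
  have hL0 : (0 : ℝ) < L := lt_of_lt_of_le (by positivity) hL1
  have hL2 : (L : ℝ) ≤ 320 / θ := by
    have h1 : (L : ℝ) < 256 / θ + 1 := by rw [hL]; exact Nat.ceil_lt_add_one (by positivity)
    have h2 : 256 / θ + 64 ≤ 320 / θ := by
      rw [div_add' _ _ _ hθ0.ne']
      exact div_le_div_of_nonneg_right (by linarith) hθ0.le
    linarith
  -- This dominates both entry bounds: `4 / (θ * n)` for the doubly stochastic kernels and `512 / (α
  -- * θ ^ 2 * n)` for the kernels at the top.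
  obtain ⟨κ, hκ⟩ : ∃ κ, κ = 512 / (θ ^ 3 * n) := ⟨_, rfl⟩
  have hκ0 : 0 < κ := by rw [hκ]; positivity
  obtain ⟨η, hη⟩ : ∃ η, η = θ / 32 := ⟨_, rfl⟩
  have hη0 : 0 < η := by rw [hη]; positivity
  have hη1 : η ≤ 1 := by rw [hη]; linarith
  have hκm : κ * ⌊M⌋₊ ≤ 1 / (θ * x) := by
    calc κ * ⌊M⌋₊ ≤ κ * M := mul_le_mul_of_nonneg_left hmM hκ0.le
      _ = 1 / (θ * x) := by rw [hκ, hM]; field_simp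
  have hLκm : L * (κ * ⌊M⌋₊) ≤ η / 4 := by
    calc L * (κ * ⌊M⌋₊) ≤ 320 / θ * (1 / (θ * x)) := by gcongr
      _ = 320 / (θ ^ 2 * x) := by field_simp
      _ ≤ η / 4 := by
        rw [hη, div_div, div_le_div_iff₀ (by positivity) (by positivity)]
        have : θ * (θ ^ 2 * x) = x * θ ^ 3 := by ring
        rw [this]; linarith
  have hκm1 : κ * ⌊M⌋₊ ≤ 1 / 2 := by
    have h1 : (1 : ℝ) ≤ L := by
      have : (1 : ℝ) ≤ 256 / θ := by rw [le_div_iff₀ hθ0]; linarith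
      linarith
    have h2 : 0 ≤ κ * ⌊M⌋₊ := by positivity
    nlinarith
  have h1κm : 0 < 1 - κ * ⌊M⌋₊ := by linarith
  refine ⟨⌊S⌋₊, ⌊M⌋₊, L, η / 4, η, κ, 1 / (1 - κ * ⌊M⌋₊), 16 * x / α, ?_, by positivity, by linarith,
    hη0.le, by positivity, hs0, hm0, by exact_mod_cast hL0, hsS.trans hS.le, ?_, ?_, by positivity,
    ?_, ?_, ?_, ?_⟩
  · have : θ * n ≤ α * n := by gcongr
    linarith
  · rw [hκ]
    calc 1 / (⌊S⌋₊ : ℝ) ≤ 1 / (S / 2) := one_div_le_one_div_of_le (by linarith) hsS2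
      _ = 4 / (θ * n) := by rw [hSθ]; field_simp; norm_num
      _ ≤ 512 / (θ ^ 3 * n) := by
        apply div_le_div₀ (by norm_num) (by norm_num) (by positivity)
        apply mul_le_mul_of_nonneg_right _ hn0.le
        exact pow_le_of_le_one hθ0.le hθ1 (by norm_num)
  · rw [hκ, hη]
    have h1 : (α / 2) ^ 2 * (θ / 32 / 4) * (ε * n) = α * θ ^ 2 * n / 512 := by
      rw [hθ]; ring
    rw [h1, one_div_div]
    apply div_le_div_of_nonneg_left (by norm_num) (by positivity)
    apply mul_le_mul_of_nonneg_right _ hn0.le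
    calc θ ^ 3 = θ * θ ^ 2 := by ring
      _ ≤ α * θ ^ 2 := by gcongr
  · rw [one_div_mul_cancel h1κm.ne']
  · have h1 : 1 - η / 4 ≤ (1 - κ * ⌊M⌋₊) ^ L := by
      have := one_add_mul_le_pow (a := -(κ * ⌊M⌋₊)) (by linarith) L
      rw [← sub_eq_add_neg] at this
      linarith
    rw [one_div_pow, div_div, div_le_iff₀ (by
      have := pow_pos h1κm L
      have : 0 < 1 - η / 4 := by linarith
      positivity)]
    have h2 : (1 - η / 4) * (1 - η / 4) ≤ (1 - κ * ⌊M⌋₊) ^ L * (1 - η / 4) :=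
      mul_le_mul_of_nonneg_right h1 (by linarith)
    have h3 : 1 ≤ (1 + η) * ((1 - η / 4) * (1 - η / 4)) := one_le_one_add_mul_sq hη0.le hη1
    exact h3.trans (mul_le_mul_of_nonneg_left h2 (by linarith))
  · calc 16 * x / α * ⌊M⌋₊ ≤ 16 * x / α * M := by gcongr
      _ = ε * n * (θ / 32) := by rw [hM, hθ]; field_simp; ring
      _ ≤ ε * n := mul_le_of_le_one_right (by positivity) (by linarith)
  · intro N Δ k hN hΔ hk
    have hN' : (N : ℝ) ≤ n := by exact_mod_cast hN
    -- The logarithm in `n / m` cancels the one in the bound on `Δ`, leaving order `c * n / θ ^ 2`;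
    -- this is why `c` must be at most a small multiple of `θ ^ 3`.
    have hkθ : (k : ℝ) ≤ θ * n / 64 := by
      have h1 : (k : ℝ) ≤ ((N / ⌊M⌋₊ : ℕ) + 1) * Δ + ((N / L : ℕ) + 1) := by exact_mod_cast hk
      have h2 : ((N / ⌊M⌋₊ : ℕ) : ℝ) ≤ 1024 * x / θ ^ 2 := by
        calc ((N / ⌊M⌋₊ : ℕ) : ℝ) ≤ (N : ℝ) / ⌊M⌋₊ := Nat.cast_div_le
          _ ≤ n / (M / 2) := div_le_div₀ hn0.le hN' (by linarith) hmM2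
          _ = _ := by rw [hM]; field_simp; norm_num
      have h3 : ((N / L : ℕ) : ℝ) ≤ θ * n / 256 := by
        calc ((N / L : ℕ) : ℝ) ≤ (N : ℝ) / L := Nat.cast_div_le
          _ ≤ n / (256 / θ) := div_le_div₀ hn0.le hN' (by positivity) hL1
          _ = _ := by field_simp
      have h4 : (1 : ℝ) ≤ x / θ ^ 2 := by
        rw [le_div_iff₀ (by positivity)]
        have := pow_le_one₀ (n := 2) hθ0.le hθ1
        linarith
      have h5 : (((N / ⌊M⌋₊ : ℕ) : ℝ) + 1) * Δ ≤ (1025 * x / θ ^ 2) * (2 * (c * n / x)) := by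
        rw [hx]
        rw [hx] at h2 h4
        apply mul_le_mul _ hΔ (by positivity)
        · rw [← hx]; positivity
        · have : 1025 * Real.log n / θ ^ 2 = 1024 * Real.log n / θ ^ 2 + Real.log n / θ ^ 2 := by
            ring
          linarith
      have h6 : (1025 * x / θ ^ 2) * (2 * (c * n / x)) = 2050 * c * n / θ ^ 2 := by
        field_simp; ring
      have h7 : 2050 * c * n / θ ^ 2 ≤ θ * n / 256 := by
        rw [div_le_div_iff₀ (by positivity) (by norm_num)]
        have : 2050 * c * 256 ≤ θ ^ 3 := by linarith
        nlinarith [mul_le_mul_of_nonneg_right this hn0.le]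
      linarith
    have hl0 : 0 < 16 * x / α := by positivity
    have hlog2 : 2 * (n : ℝ) ≤ Real.exp (16 * x / α * (α / 8)) := by
      have h1 : 16 * x / α * (α / 8) = x + x := by field_simp; norm_num
      rw [h1, Real.exp_add, hx, Real.exp_log hn0]
      exact mul_le_mul_of_nonneg_right (by linarith) hn0.le
    -- With `l = 16 * x / α`, the prefactor `2 * n` costs `l * α / 8` and each of the three errors
    -- costs `l * α / 32`: together `7/32 * l * α`, below the available `l * α / 4`.
    have e1 : 2 * (16 * x / α) / (ε * n) * k ≤ 16 * x / α * (α / 32) := by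
      calc 2 * (16 * x / α) / (ε * n) * k ≤ 2 * (16 * x / α) / (ε * n) * (θ * n / 64) := by gcongr
        _ = _ := by rw [hθ]; field_simp; norm_num
    have e2 : 16 * x / α * η / (ε * n) * N ≤ 16 * x / α * (α / 32) := by
      calc 16 * x / α * η / (ε * n) * N ≤ 16 * x / α * η / (ε * n) * n := by gcongr
        _ = _ := by rw [hη, hθ]; field_simp
    have e3 : (16 * x / α) ^ 2 * ⌊M⌋₊ / (ε * n) ^ 2 * N ≤ 16 * x / α * (α / 32) := by
      calc (16 * x / α) ^ 2 * ⌊M⌋₊ / (ε * n) ^ 2 * N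
          ≤ (16 * x / α) ^ 2 * M / (ε * n) ^ 2 * n := by gcongr
        _ = _ := by rw [hM, hθ]; field_simp; norm_num
    rw [mul_assoc, ← Real.exp_add]
    refine lt_of_le_of_lt (mul_le_mul_of_nonneg_right hlog2 (Real.exp_pos _).le) ?_
    rw [← Real.exp_add]
    apply Real.exp_lt_exp.2
    have e4 : 0 < 16 * x / α * α := by positivity
    rw [add_mul]
    generalize 16 * x / α = l at e1 e2 e3 e4 ⊢
    linarith

/-! ### Application to digraphs. -/

namespace Digraph

/-- Adjacency of a digraph along an edge with prescribed direction. -/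
def DirAdj {V : Type*} (D : Digraph V) (b : Bool) (a x : V) : Prop :=
  if b then D.Adj a x else D.Adj x a

theorem dirAdj_iff_not {V : Type*} (D : Digraph V) (b : Bool) (a x : V) :
    D.DirAdj b a x ↔ D.DirAdj (!b) x a := by
  cases b <;> simp [DirAdj]

open Classical in
theorem minSemidegree_le_card_filter {V : Type*} [Fintype V] (D : Digraph V) (b : Bool) (v : V) :
    D.minSemidegree ≤ (Finset.univ.filter fun x => D.DirAdj b v x).card := by
  have h : D.minSemidegree ≤ min (D.outDeg v) (D.inDeg v) := ciInf_le (OrderBot.bddBelow _) v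
  cases b
  · simpa [DirAdj, inDeg, inNbrs] using h.trans (min_le_right _ _)
  · simpa [DirAdj, outDeg, outNbrs] using h.trans (min_le_left _ _)

open Classical in
/-- A vertex of a digraph has boundedly many neighbours in the underlying graph. -/
theorem card_underlying_nbrs_le {W : Type*} [Fintype W] (T : Digraph W) (s : W) (P : W → Prop)
    (hP : ∀ z, P z → T.toSimpleGraphInclusive.Adj s z) :
    (Finset.univ.filter P).card ≤ T.maxOutDeg + T.maxInDeg := by
  have hsub : Finset.univ.filter P ⊆ T.outNbrs s ∪ T.inNbrs s := by
    intro z hz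
    have := hP z (Finset.mem_filter.1 hz).2
    simp only [outNbrs, inNbrs, Finset.mem_union, Finset.mem_filter, Finset.mem_univ, true_and]
    exact this.2
  refine (Finset.card_le_card hsub).trans ((Finset.card_union_le _ _).trans ?_)
  exact add_le_add (Finset.le_sup (f := T.outDeg) (Finset.mem_univ s))
    (Finset.le_sup (f := T.inDeg) (Finset.mem_univ s))

open Classical in
/-- Deleting one vertex from a digraph of large minimum semidegree leaves a small potential. -/
theorem densityPotential_univ_sdiff_singleton_le {V : Type*} [Fintype V] (D : Digraph V)
    (α l : ℝ) (hl : 0 < l) (hα : 2 ≤ α * Fintype.card V) (v : V)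
    (hD : (1 / 2 + α) * Fintype.card V ≤ D.minSemidegree) :
    densityPotential D.DirAdj l (Finset.univ \ {v}) ≤
      2 * Fintype.card V * Real.exp (-l * (1 / 2 + 3 * α / 4)) := by
  set n : ℝ := (Fintype.card V : ℝ) with hn
  have hcard : ((Finset.univ \ {v} : Finset V).card : ℝ) = n - 1 := by
    rw [Finset.card_sdiff_of_subset (Finset.subset_univ _), Finset.card_univ,
      Finset.card_singleton, Nat.cast_sub (Fintype.card_pos_iff.2 ⟨v⟩), Nat.cast_one]
  have hdens : ∀ j, 1 / 2 + 3 * α / 4 ≤ nbrDensity D.DirAdj (Finset.univ \ {v}) j := by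
    intro j
    have h1 := D.minSemidegree_le_card_filter j.1 j.2
    have h2 : (Finset.univ.filter fun x => D.DirAdj j.1 j.2 x).card ≤
        ((Finset.univ \ {v}).filter fun x => D.DirAdj j.1 j.2 x).card + 1 := by
      rw [← Finset.card_singleton v]
      refine (Finset.card_le_card ?_).trans (Finset.card_union_le _ _)
      intro x
      simp only [Finset.mem_filter, Finset.mem_union, Finset.mem_sdiff, Finset.mem_singleton,
        Finset.mem_univ, true_and]
      tauto
    have h3 : (D.minSemidegree : ℝ) ≤
        ((Finset.univ \ {v}).filter fun x => D.DirAdj j.1 j.2 x).card + 1 := by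
      exact_mod_cast h1.trans h2
    have h4 : (((Finset.univ \ {v}).filter fun x => D.DirAdj j.1 j.2 x).card : ℝ) ≤ n - 1 := by
      rw [← hcard]
      exact_mod_cast Finset.card_filter_le _ _
    have hn1 : 0 < n - 1 := by linarith
    unfold nbrDensity
    rw [hcard, le_div_iff₀ hn1]
    have hα0 : 0 < α := by
      by_contra h
      have : α * n ≤ 0 := mul_nonpos_of_nonpos_of_nonneg (not_lt.1 h) (by linarith)
      linarith
    linarith
  calc densityPotential D.DirAdj l (Finset.univ \ {v})
      ≤ ∑ j : Bool × V, Real.exp (-l * (1 / 2 + 3 * α / 4)) := by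
        refine Finset.sum_le_sum fun j _ => Real.exp_le_exp.2 ?_
        have := mul_le_mul_of_nonneg_left (hdens j) hl.le
        linarith
    _ = _ := by
        rw [Finset.sum_const, Finset.card_univ, Fintype.card_prod, Fintype.card_bool, nsmul_eq_mul]
        push_cast
        rfl

/-- Every almost spanning oriented tree of small maximum degree embeds into a digraph of large
minimum semidegree, with one vertex prescribed. -/
theorem containsCopyAt_of_minSemidegree {V W : Type*} [Fintype V] [Fintype W] (ε α c : ℝ)
    (hε : 0 < ε) (hε1 : ε ≤ 1) (hα : 0 < α) (hα1 : α ≤ 1) (hc : 0 < c)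
    (hcf : c ≤ (ε * α) ^ 3 / 10 ^ 6) (n : ℕ) (hn : 0 < n) (hlog : 1 / c ≤ Real.log n)
    (D : Digraph V) (hV : Fintype.card V = n) (hD : (1 / 2 + α) * n ≤ D.minSemidegree) (v : V)
    (T : Digraph W) (hT : T.IsOrientedTree) (hW : (Fintype.card W : ℝ) ≤ (1 - ε) * n)
    (hout : (T.maxOutDeg : ℝ) ≤ c * n / Real.log n) (hin : (T.maxInDeg : ℝ) ≤ c * n / Real.log n)
    (t : W) : D.ContainsCopyAt v T t := by
  classical
  obtain ⟨s, m, L, ζ, η, κ, ρ, l, hαn, hζ, hζ1, hη, hl, hs, hm, hL, hsβ, hκ1, hκ2, hρ0, hρ, hρL,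
    hlm, hfin⟩ := exists_embedding_parameters ε α c hε hε1 hα hα1 hc hcf n hn hlog
  obtain ⟨par, d, -, hpar, hedge⟩ := hT.2.exists_parent t
  have hn0 : (0 : ℝ) < n := by exact_mod_cast hn
  obtain ⟨fr, hfr, hfrm, hroots⟩ := exists_fragmentation par d t (fun w hw => (hpar w hw).2) m L
    (T.maxOutDeg + T.maxInDeg) hm hL (fun s => by
      convert T.card_underlying_nbrs_le s (fun z => z ≠ t ∧ par z = s) (fun z hz => by
        rw [← hz.2]; exact (hpar z hz.1).1))
  have hWn : Fintype.card W ≤ n := by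
    have : (Fintype.card W : ℝ) ≤ n := hW.trans (mul_le_of_le_one_left hn0.le (by linarith))
    exact_mod_cast this
  have hpot := densityPotential_univ_sdiff_singleton_le D α l hl (by rw [hV]; exact hαn) v
    (by rw [hV]; exact hD)
  rw [hV] at hpot
  obtain ⟨φ, hφi, hφt, hφ⟩ := exists_embedding_of_fragmentation D.DirAdj D.dirAdj_iff_not v par d t
    (fun w => decide (T.Adj (par w) w)) fr (α / 2) ζ η κ ρ l (ε * n) (by positivity) hζ hζ1 hη hl
    (by positivity) s m L hs hsβ hκ1 hκ2 hρ0 hρ hρL hlm (by rw [hV]; linarith)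
    (fun w hw => (hpar w hw).2) hfr hfrm
    (lt_of_le_of_lt (mul_le_mul_of_nonneg_right hpot (Real.exp_pos _).le)
      (hfin _ (T.maxOutDeg + T.maxInDeg) _ hWn (by push_cast; linarith) hroots))
  refine ⟨φ, hφi, fun a b hab => ?_, hφt⟩
  have hba := hT.1 a b hab
  have hne : a ≠ b := by
    rintro rfl
    exact hba hab
  -- Every edge joins a vertex to its parent; if `a` is the child, antisymmetry of `T` makes its
  -- recorded direction `false`, which is again an edge from the image of `a` to that of `b`.
  rcases hedge a b ⟨hne, Or.inl hab⟩ with ⟨hb, h⟩ | ⟨ha, h⟩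
  · have := hφ b hb
    rw [h] at this
    simpa [DirAdj, hab] using this
  · have := hφ a ha
    rw [h] at this
    simpa [DirAdj, hba] using this

end Digraph

theorem theorem3 :
    ∃ f : Set.Ioc (0 : ℝ) 1 × Set.Ioc (0 : ℝ) 1 → Set.Ioc (0 : ℝ) 1, Monotone f ∧
    ∃ g : Set.Ioc (0 : ℝ) 1 → Set.Ioc (0 : ℝ) 1, Monotone g ∧
    ∀ (ε α c : Set.Ioc (0 : ℝ) 1) (n : ℕ), 0 < n →
      c ≤ f (ε, α) → 1 / (n : ℝ) ≤ (g c : ℝ) →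
      ∀ (V : Type*) [Fintype V] (D : Digraph V), Fintype.card V = n →
        (1 / 2 + (α : ℝ)) * (n : ℝ) ≤ (D.minSemidegree : ℝ) →
      ∀ v : V,
      ∀ (W : Type*) [Fintype W] (T : Digraph W), T.IsOrientedTree →
        (Fintype.card W : ℝ) ≤ (1 - (ε : ℝ)) * (n : ℝ) →
        (T.maxOutDeg : ℝ) ≤ (c : ℝ) * (n : ℝ) / Real.log (n : ℝ) →
        (T.maxInDeg : ℝ) ≤ (c : ℝ) * (n : ℝ) / Real.log (n : ℝ) →
      ∀ t : W, D.ContainsCopyAt v T t := by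
  -- With `g c = exp (-1 / c)`, the condition `1 / n ≤ g c` says exactly that `log n ≥ 1 / c`.
  refine ⟨fun p => ⟨((p.1 : ℝ) * p.2) ^ 3 / 10 ^ 6, ?_, ?_⟩, ?_,
    fun c => ⟨Real.exp (-(1 / (c : ℝ))), Real.exp_pos _, ?_⟩, ?_, ?_⟩
  · have h1 := p.1.2.1
    have h2 := p.2.2.1
    positivity
  · have h1 : (p.1 : ℝ) * p.2 ≤ 1 := mul_le_one₀ p.1.2.2 p.2.2.1.le p.2.2.2
    have h2 : ((p.1 : ℝ) * p.2) ^ 3 ≤ 1 :=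
      pow_le_one₀ (mul_nonneg p.1.2.1.le p.2.2.1.le) h1
    linarith
  · intro p q hpq
    have h1 : (p.1 : ℝ) ≤ q.1 := hpq.1
    have h2 : (p.2 : ℝ) ≤ q.2 := hpq.2
    have h3 : (0 : ℝ) < p.1 := p.1.2.1
    have h4 : (0 : ℝ) < p.2 := p.2.2.1
    have h5 : (0 : ℝ) < q.1 := q.1.2.1
    show ((p.1 : ℝ) * p.2) ^ 3 / 10 ^ 6 ≤ ((q.1 : ℝ) * q.2) ^ 3 / 10 ^ 6
    gcongr
  · have : 0 ≤ 1 / (c : ℝ) := one_div_nonneg.2 c.2.1.le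
    exact Real.exp_le_one_iff.2 (by linarith)
  · intro a b hab
    have h1 : (a : ℝ) ≤ b := hab
    exact Real.exp_le_exp.2 (neg_le_neg (one_div_le_one_div_of_le a.2.1 h1))
  · intro ε α c n hn hcf hcg V _ D hV hD v W _ T hT hW hout hin t
    have hn0 : (0 : ℝ) < n := by exact_mod_cast hn
    have hcg' : 1 / (n : ℝ) ≤ Real.exp (-(1 / (c : ℝ))) := hcg
    have hlog : 1 / (c : ℝ) ≤ Real.log n := by
      rw [Real.le_log_iff_exp_le hn0]
      rw [Real.exp_neg, one_div] at hcg'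
      exact (inv_le_inv₀ hn0 (Real.exp_pos _)).1 hcg'
    exact Digraph.containsCopyAt_of_minSemidegree ε α c ε.2.1 ε.2.2 α.2.1 α.2.2 c.2.1 hcf n hn hlog
      D hV hD v T hT hW hout hin t
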